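/- All graphs are finite and simple, and $C_m$, $P_m$ denote the cycle and the path on $m$ vertices. For a graph $G$ and $D \subseteq V(G)$, let $N[D]$ be the set consisting of the vertices of $D$ and all their neighbours. The set $D$ is called a 1-isolating set of $G$ if $\Delta(G - N[D]) \le 1$, that is, if every component of $G - N[D]$ is an isolated vertex or an isolated edge. The 1-isolation number $\iota_1(G)$ is the minimum cardinality of a 1-isolating set of $G$. **Theorem 1.7.** Let $G$ be a connected graph of order $n$ that contains neither $C_5$ nor $C_6$ as an induced subgraph and is not isomorphic to any of $P_3, C_3, C_7, C_{11}$. Then $$\iota_1(G) \le \frac{n}{4}.$$ This bound is sharp: for every integer $t \ge 1$ there is such a graph $G$ of order $n = 4t$ with $\iota_1(G) = \frac{n}{4}$. -/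

import Mathlib

namespace SimpleGraph

/-- The closed neighbourhood `N[D]` of a set `D` of vertices: the vertices of `D` together with all
their neighbours. -/
def closedNeighborhood {V : Type*} (G : SimpleGraph V) (D : Set V) : Set V :=
  {v | v ∈ D ∨ ∃ u ∈ D, G.Adj u v}

open Classical in
/-- `D` is a `k`-isolating set of the finite graph `G` if `Δ(G - N[D]) ≤ k`, where `G - N[D]` is
the subgraph induced on the vertices outside `N[D]`. (The graph without vertices has maximum
degree `0` in Mathlib, so a dominating set is `k`-isolating.) -/
def IsIsolatingSet {V : Type*} [Fintype V] (G : SimpleGraph V) (k : ℕ) (D : Finset V) : Prop :=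
  (G.induce (G.closedNeighborhood (D : Set V))ᶜ).maxDegree ≤ k

/-- The `k`-isolation number `ι_k(G)`: the least cardinality of a `k`-isolating set of `G`.
(The set of all vertices is `k`-isolating, so the infimum is a minimum.) -/
noncomputable def isolationNumber {V : Type*} [Fintype V] (G : SimpleGraph V) (k : ℕ) : ℕ :=
  sInf {m : ℕ | ∃ D : Finset V, G.IsIsolatingSet k D ∧ D.card = m}

/-- `G` is one of `P₃, C₃, C₇, C₁₁`, up to isomorphism. -/
def IsExceptionalGraph {V : Type*} (G : SimpleGraph V) : Prop :=
  Nonempty (G ≃g pathGraph 3) ∨ Nonempty (G ≃g cycleGraph 3) ∨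
    Nonempty (G ≃g cycleGraph 7) ∨ Nonempty (G ≃g cycleGraph 11)

end SimpleGraph

namespace SimpleGraph

open scoped Classical

/-! ### Undominated vertices, components, bad sets, and the budget reduction -/

section

/-! The bound is proved for vertex sets: every connected set is `Good` (a quarter of its vertices
isolates it) or `Bad` (it induces P₃, C₃, C₇ or C₁₁). A bad set C has order 3 mod 4; (|C|+1)/4
vertices isolate it, and (|C|-3)/4 do once some chosen vertex outside is adjacent to it.
`good_of_partial` turns this into a budget: remove R, spend D₀ on it, and let each bad component of
the rest cost one unit (a quarter of a vertex) if D₀ misses it and repay three if D₀ touches it.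

Let S be a minimal counterexample, v a vertex of degree d ≥ 3, and b the number of bad components of
S - N[v]. Each of these is touched by at least two neighbours of v, since otherwise deleting a
single vertex would already pay. Trying D₀ = {v} ∪ X for all X ⊆ N(v) gives d ≤ b + 2 and shows that
no neighbour of v touches two bad components (`hitting_count`). A bad component H touched by exactly
two neighbours of v is impossible (`IsMinCounterexample.false_of_pair`): without induced C₅ and C₆,
H has an isolating set of size at most (|H|+1)/4 that dominates both. Hence 3b ≤ d ≤ b + 2, so d = 3
and b = 1.

There remains maximum degree three with all three neighbours of v attached to a single H
(`CubicConfig`). Degree counting and the forbidden cycles restrict the attachments so much that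
either they contradict each other or H has an isolating set within budget that also settles N[v]
(`CubicConfig.false_of_isolates`). So S has maximum degree at most two. It is spanned by a path, and
explicit choices of every fourth or fifth vertex finish (`IsConn.good_or_bad_of_degree_le_two`).

For sharpness, take t copies of K₄ and join one hub from each into a clique: the three other
vertices of a copy form a triangle that survives unless the copy contains a chosen vertex. -/

/-- `u` lies outside the closed neighbourhood of `D`. -/
def Undominated {V : Type*} (G : SimpleGraph V) (D : Finset V) (u : V) : Prop :=
  u ∉ D ∧ ∀ d ∈ D, ¬ G.Adj d u

/-- The vertices of `S` undominated by `D` induce a graph of maximum degree at most one. -/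
def Isolates {V : Type*} (G : SimpleGraph V) (D S : Finset V) : Prop :=
  ∀ u ∈ S, ∀ a ∈ S, ∀ b ∈ S, G.Undominated D u → G.Undominated D a → G.Undominated D b →
    G.Adj u a → G.Adj u b → a = b

/-- `S` is nonempty and has no proper nonempty subset without outgoing edges inside `S`. -/
def IsConn {V : Type*} (G : SimpleGraph V) (S : Finset V) : Prop :=
  S.Nonempty ∧ ∀ A ⊆ S, A.Nonempty → (∀ a ∈ A, ∀ b ∈ S, G.Adj a b → b ∈ A) → A = S

/-- `C` is the vertex set of a component of the subgraph induced on `T`. -/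
def IsComp {V : Type*} (G : SimpleGraph V) (T C : Finset V) : Prop :=
  C ⊆ T ∧ G.IsConn C ∧ ∀ a ∈ C, ∀ b ∈ T, G.Adj a b → b ∈ C

/-- The vertex sets of the components of the subgraph induced on `T`. -/
noncomputable def comps {V : Type*} (G : SimpleGraph V) (T : Finset V) : Finset (Finset V) :=
  T.powerset.filter (G.IsComp T)

/-- `f` enumerates an induced cycle of length `n` (for `n ≥ 3`). -/
def CycleOn {V : Type*} (G : SimpleGraph V) {n : ℕ} [NeZero n] (f : Fin n → V) : Prop :=
  Function.Injective f ∧ ∀ i j, G.Adj (f i) (f j) ↔ j = i + 1 ∨ i = j + 1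

/-- The set `C` induces one of `P₃, C₃, C₇, C₁₁`. -/
def Bad {V : Type*} (G : SimpleGraph V) (C : Finset V) : Prop :=
  (C.card = 3 ∧ G.IsConn C) ∨ (∃ f : Fin 7 → V, G.CycleOn f ∧ C = Finset.univ.image f) ∨
    (∃ f : Fin 11 → V, G.CycleOn f ∧ C = Finset.univ.image f)

/-- At most a quarter of the vertices of `S` suffices to isolate `S`. -/
def Good {V : Type*} (G : SimpleGraph V) (S : Finset V) : Prop :=
  ∃ D : Finset V, G.Isolates D S ∧ 4 * D.card ≤ S.card

/-- Some vertex of `D` has a neighbour in `C`. -/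
def Touches {V : Type*} (G : SimpleGraph V) (D C : Finset V) : Prop :=
  ∃ d ∈ D, ∃ c ∈ C, G.Adj d c

variable {V : Type*} {G : SimpleGraph V}

theorem Undominated.mono {D D' : Finset V} (h : D ⊆ D') {u : V} (hu : G.Undominated D' u) :
    G.Undominated D u :=
  ⟨fun h' => hu.1 (h h'), fun d hd => hu.2 d (h hd)⟩

theorem Isolates.mono {D D' S : Finset V} (h : D ⊆ D') (hD : G.Isolates D S) :
    G.Isolates D' S := fun u hu a ha b hb h1 h2 h3 =>
  hD u hu a ha b hb (h1.mono h) (h2.mono h) (h3.mono h)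

/-- Only undominated vertices matter for isolation. -/
theorem Isolates.of_undominated {D S T : Finset V} (hD : G.Isolates D T)
    (h : ∀ u ∈ S, G.Undominated D u → u ∈ T) : G.Isolates D S := fun u hu a ha b hb h1 h2 h3 =>
  hD u (h u hu h1) a (h a ha h2) b (h b hb h3) h1 h2 h3

/-- Two undominated vertices are harmless. -/
theorem isolates_of_card_le_two {D S T : Finset V} (hT : T.card ≤ 2)
    (h : ∀ u ∈ S, G.Undominated D u → u ∈ T) : G.Isolates D S := by
  intro u hu a ha b hb h1 h2 h3 hua hub
  by_contra hab
  have : ({u, a, b} : Finset V) ⊆ T := by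
    intro x hx
    simp only [Finset.mem_insert, Finset.mem_singleton] at hx
    rcases hx with rfl | rfl | rfl
    exacts [h _ hu h1, h _ ha h2, h _ hb h3]
  have h3 : ({u, a, b} : Finset V).card = 3 := Finset.card_eq_three.2
    ⟨u, a, b, hua.ne, hub.ne, hab, rfl⟩
  have := Finset.card_le_card this
  omega

theorem mem_comps {T C : Finset V} : C ∈ G.comps T ↔ G.IsComp T C := by
  simp only [comps, Finset.mem_filter, Finset.mem_powerset, and_iff_right_iff_imp]
  exact fun h => h.1

theorem IsComp.subset_of_mem {T C C' : Finset V} (hC : G.IsComp T C) (hC' : G.IsComp T C')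
    {x : V} (hx : x ∈ C) (hx' : x ∈ C') : C ⊆ C' := by
  have := hC.2.1.2 (C ∩ C') Finset.inter_subset_left ⟨x, by simp [hx, hx']⟩ (by
    intro a ha b hb hab
    rw [Finset.mem_inter] at ha ⊢
    exact ⟨hb, hC'.2.2 a ha.2 b (hC.1 hb) hab⟩)
  rw [← this]
  exact Finset.inter_subset_right

theorem IsComp.eq_of_mem {T C C' : Finset V} (hC : G.IsComp T C) (hC' : G.IsComp T C')
    {x : V} (hx : x ∈ C) (hx' : x ∈ C') : C = C' :=
  (hC.subset_of_mem hC' hx hx').antisymm (hC'.subset_of_mem hC hx' hx)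

/-- A smallest closed set A containing x works: if a closed B ⊆ A missed x, then A \ B would be
closed too, by symmetry of adjacency, and smaller. -/
theorem exists_isComp {T : Finset V} {x : V} (hx : x ∈ T) : ∃ C, G.IsComp T C ∧ x ∈ C := by
  obtain ⟨A, hA, hmin⟩ := Finset.exists_min_image
    (T.powerset.filter fun A => x ∈ A ∧ ∀ a ∈ A, ∀ b ∈ T, G.Adj a b → b ∈ A) Finset.card
    ⟨T, by simp only [Finset.mem_filter, Finset.mem_powerset]; tauto⟩
  simp only [Finset.mem_filter, Finset.mem_powerset] at hA hmin
  obtain ⟨hAT, hxA, hcl⟩ := hA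
  refine ⟨A, ⟨hAT, ⟨⟨x, hxA⟩, fun B hBA hBne hB => ?_⟩, hcl⟩, hxA⟩
  by_cases hxB : x ∈ B
  · refine Finset.eq_of_subset_of_card_le hBA (hmin B ⟨hBA.trans hAT, hxB, fun a ha b hb hab => ?_⟩)
    exact hB a ha b (hcl a (hBA ha) b hb hab) hab
  · exfalso
    have := hmin (A \ B) ⟨Finset.sdiff_subset.trans hAT, by simp [hxA, hxB], by
      intro a ha b hb hab
      rw [Finset.mem_sdiff] at ha ⊢
      exact ⟨hcl a ha.1 b hb hab, fun hbB => ha.2 (hB b hbB a ha.1 hab.symm)⟩⟩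
    rw [Finset.card_sdiff_of_subset hBA] at this
    have h1 := Finset.card_pos.2 hBne
    have h2 := Finset.card_le_card hBA
    omega

theorem card_eq_sum_comps (T : Finset V) : T.card = ∑ C ∈ G.comps T, C.card := by
  rw [← Finset.card_biUnion]
  · congr 1
    ext x
    simp only [Finset.mem_biUnion, mem_comps]
    exact ⟨fun h => exists_isComp h, fun ⟨C, hC, hx⟩ => hC.1 hx⟩
  · intro C hC C' hC' hne
    rw [Finset.mem_coe, mem_comps] at hC hC'
    exact Finset.disjoint_left.2 fun x hx hx' => hne (hC.eq_of_mem hC' hx hx')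

/-- On a cycle it suffices that no three consecutive vertices are undominated. -/
theorem CycleOn.isolates {n : ℕ} [NeZero n] {f : Fin n → V} (hf : G.CycleOn f) {D : Finset V}
    (h : ∀ i, ¬ (G.Undominated D (f i) ∧ G.Undominated D (f (i + 1)) ∧
      G.Undominated D (f (i + 1 + 1)))) : G.Isolates D (Finset.univ.image f) := by
  intro u hu a ha b hb h1 h2 h3 hua hub
  simp only [Finset.mem_image, Finset.mem_univ, true_and] at hu ha hb
  obtain ⟨i, rfl⟩ := hu
  obtain ⟨j, rfl⟩ := ha
  obtain ⟨k, rfl⟩ := hb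
  rw [hf.2] at hua hub
  rcases hua with rfl | rfl <;> rcases hub with h' | h'
  · rw [h']
  · subst h'; exact absurd ⟨h3, h1, h2⟩ (h k)
  · subst h'; exact absurd ⟨h2, h1, h3⟩ (h j)
  · rw [add_right_cancel h']

/-- On a cycle it suffices that every three consecutive vertices meet a dominated set of indices. -/
theorem CycleOn.isolates_of_index {n : ℕ} [NeZero n] {f : Fin n → V} (hf : G.CycleOn f)
    {D : Finset V} (J : Finset (Fin n)) (hJ : ∀ j ∈ J, ¬ G.Undominated D (f j))
    (h : ∀ i, i ∈ J ∨ i + 1 ∈ J ∨ i + 1 + 1 ∈ J) : G.Isolates D (Finset.univ.image f) := by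
  refine hf.isolates fun i hi => ?_
  rcases h i with h | h | h
  exacts [hJ _ h hi.1, hJ _ h hi.2.1, hJ _ h hi.2.2]

/-- A set of indices dominates itself and its two shifts. -/
theorem CycleOn.not_undominated {n : ℕ} [NeZero n] {f : Fin n → V} (hf : G.CycleOn f)
    {D : Finset V} {i j : Fin n} (hi : f i ∈ D) (h : j = i ∨ j = i + 1 ∨ i = j + 1) :
    ¬ G.Undominated D (f j) := by
  rintro ⟨h1, h2⟩
  rcases h with rfl | h
  · exact h1 hi
  · exact h2 _ hi ((hf.2 i j).2 h)

/-- The window i, i+1, i+2 meets the closed neighbourhood of a chosen index exactly when that index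
lies between i-1 and i+3. In this form `decide` settles concrete lengths. -/
theorem CycleOn.isolates_image {n : ℕ} [NeZero n] {f : Fin n → V} (hf : G.CycleOn f)
    {D : Finset V} (I : Finset (Fin n)) (hI : ∀ i ∈ I, f i ∈ D)
    (h : ∀ i : Fin n, ∃ k ∈ I, k + 1 = i ∨ k = i ∨ k = i + 1 ∨ k = i + 1 + 1 ∨ k = i + 1 + 1 + 1) :
    G.Isolates D (Finset.univ.image f) := by
  refine hf.isolates fun i hi => ?_
  obtain ⟨k, hk, h⟩ := h i
  rcases h with h | h | h | h | h
  · exact hf.not_undominated (hI k hk) (Or.inr (Or.inl h.symm)) hi.1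
  · exact hf.not_undominated (hI k hk) (Or.inl h.symm) hi.1
  · exact hf.not_undominated (hI k hk) (Or.inl h.symm) hi.2.1
  · exact hf.not_undominated (hI k hk) (Or.inl h.symm) hi.2.2
  · exact hf.not_undominated (hI k hk) (Or.inr (Or.inr h)) hi.2.2

theorem CycleOn.rotate {n : ℕ} [NeZero n] {f : Fin n → V} (hf : G.CycleOn f) (k : Fin n) :
    G.CycleOn (fun i => f (k + i)) := by
  refine ⟨fun i j h => add_left_cancel (hf.1 h), fun i j => ?_⟩
  rw [hf.2, add_assoc, add_assoc, add_right_inj, add_right_inj]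

theorem image_rotate {n : ℕ} [NeZero n] (f : Fin n → V) (k : Fin n) :
    Finset.univ.image (fun i => f (k + i)) = Finset.univ.image f := by
  ext x
  simp only [Finset.mem_image, Finset.mem_univ, true_and]
  exact ⟨fun ⟨i, hi⟩ => ⟨_, hi⟩, fun ⟨i, hi⟩ => ⟨i - k, by rw [add_sub_cancel, hi]⟩⟩

/-- A cycle can be enumerated starting from any of its vertices. -/
theorem CycleOn.exists_rotate {n : ℕ} [NeZero n] {f : Fin n → V} (hf : G.CycleOn f) {x : V}
    (hx : x ∈ Finset.univ.image f) :
    ∃ g : Fin n → V, G.CycleOn g ∧ Finset.univ.image f = Finset.univ.image g ∧ g 0 = x := by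
  simp only [Finset.mem_image, Finset.mem_univ, true_and] at hx
  obtain ⟨k, rfl⟩ := hx
  exact ⟨_, hf.rotate k, (image_rotate f k).symm, by simp⟩

theorem CycleOn.card {n : ℕ} [NeZero n] {f : Fin n → V} (hf : G.CycleOn f) :
    (Finset.univ.image f).card = n := by
  rw [Finset.card_image_of_injective _ hf.1]; simp

theorem Bad.card_ge {C : Finset V} (h : G.Bad C) : 3 ≤ C.card := by
  rcases h with h | ⟨f, hf, rfl⟩ | ⟨f, hf, rfl⟩
  · omega
  · rw [hf.card]; omega
  · rw [hf.card]; omega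

/-- The orders 3, 7, 11 miss the quarter bound by exactly one unit. -/
theorem Bad.exists_isolates {C : Finset V} (h : G.Bad C) :
    ∃ D, G.Isolates D C ∧ 4 * D.card = C.card + 1 := by
  rcases h with ⟨h, -⟩ | ⟨f, hf, rfl⟩ | ⟨f, hf, rfl⟩
  · obtain ⟨x, hx⟩ := Finset.card_pos.1 (by omega : 0 < C.card)
    refine ⟨{x}, isolates_of_card_le_two (T := C.erase x) (by rw [Finset.card_erase_of_mem hx]; omega)
      fun u hu h => Finset.mem_erase.2 ⟨fun h' => h.1 (by simp [h']), hu⟩, by simp [h]⟩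
  · refine ⟨({0, 3} : Finset (Fin 7)).image f, hf.isolates_image {0, 3}
      (fun i hi => Finset.mem_image_of_mem f hi) (by decide), ?_⟩
    rw [hf.card, Finset.card_image_of_injective _ hf.1]; decide
  · refine ⟨({0, 4, 7} : Finset (Fin 11)).image f, hf.isolates_image {0, 4, 7}
      (fun i hi => Finset.mem_image_of_mem f hi) (by decide), ?_⟩
    rw [hf.card, Finset.card_image_of_injective _ hf.1]; decide

/-- A vertex with a neighbour in a bad set saves one vertex in isolating it. -/
theorem Bad.exists_isolates_of_adj {C : Finset V} (h : G.Bad C) {x c : V} (hc : c ∈ C)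
    (hxc : G.Adj x c) : ∃ D, G.Isolates (insert x D) C ∧ 4 * D.card + 3 = C.card := by
  have hcD : ∀ D, ¬ G.Undominated (insert x D) c := fun D h => h.2 x (by simp) hxc
  rcases h with ⟨h, -⟩ | ⟨f, hf, rfl⟩ | ⟨f, hf, rfl⟩
  · refine ⟨∅, isolates_of_card_le_two (T := C.erase c)
      (by rw [Finset.card_erase_of_mem hc]; omega)
      fun u hu h => Finset.mem_erase.2 ⟨fun h' => hcD _ (h' ▸ h), hu⟩, by simp [h]⟩
  · obtain ⟨g, hg, hfg, rfl⟩ := hf.exists_rotate hc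
    rw [hfg]
    -- `g 0` is dominated by `x`, so only the indices 1 and 5, 6 stay undominated.
    refine ⟨{g 3}, hg.isolates_of_index {0, 2, 3, 4} ?_ (by decide), ?_⟩
    · intro j hj
      by_cases hj0 : j = 0
      · subst hj0; exact hcD _
      · exact hg.not_undominated (i := 3) (by simp) (by revert j; decide)
    · rw [hg.card]; simp
  · obtain ⟨g, hg, hfg, rfl⟩ := hf.exists_rotate hc
    rw [hfg]
    refine ⟨{g 3, g 8}, hg.isolates_of_index {0, 2, 3, 4, 7, 8, 9} ?_ (by decide), ?_⟩
    · intro j hj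
      by_cases hj0 : j = 0
      · subst hj0; exact hcD _
      by_cases hj5 : j < 5
      · exact hg.not_undominated (i := 3) (by simp) (by revert j; decide)
      · exact hg.not_undominated (i := 8) (by simp) (by revert j; decide)
    · rw [hg.card, Finset.card_pair (hg.1.ne (by decide))]

/-- Isolate `R` by `D₀` and the components of the rest separately, where each bad component costs
a quarter more than its share, and three quarters less if `D₀` touches it. -/
theorem good_of_partial {S R D₀ : Finset V}
    (IH : ∀ T ⊆ S, T ≠ S → G.IsConn T → G.Good T ∨ G.Bad T) (hR : R ⊆ S) (hRne : R.Nonempty)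
    (hiso : G.Isolates D₀ R)
    (hsep : ∀ r ∈ R, ∀ t ∈ S, t ∉ R → G.Undominated D₀ r → G.Undominated D₀ t → ¬ G.Adj r t)
    (hcount : 4 * D₀.card +
        ((G.comps (S \ R)).filter fun C => G.Bad C ∧ ¬ G.Touches D₀ C).card ≤
      R.card + 3 * ((G.comps (S \ R)).filter fun C => G.Bad C ∧ G.Touches D₀ C).card) :
    G.Good S := by
  -- Per component, 4|D| is at most |C| - 3, |C| + 1 or |C|, according as C is bad and touched, bad
  -- and untouched, or good; written additively to avoid subtraction.
  have key : ∀ C ∈ G.comps (S \ R), ∃ D, G.Isolates (D₀ ∪ D) C ∧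
      4 * D.card + 3 * (if G.Bad C ∧ G.Touches D₀ C then 1 else 0) ≤
        C.card + (if G.Bad C ∧ ¬ G.Touches D₀ C then 1 else 0) := by
    intro C hC
    rw [mem_comps] at hC
    by_cases hbad : G.Bad C
    · by_cases ht : G.Touches D₀ C
      · obtain ⟨d, hd, c, hc, hdc⟩ := ht
        obtain ⟨D, hD, hcard⟩ := hbad.exists_isolates_of_adj hc hdc
        refine ⟨D, hD.mono ?_, ?_⟩
        · intro y hy
          rcases Finset.mem_insert.1 hy with rfl | hy
          exacts [Finset.mem_union_left _ hd, Finset.mem_union_right _ hy]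
        · split_ifs <;> omega
      · obtain ⟨D, hD, hcard⟩ := hbad.exists_isolates
        refine ⟨D, hD.mono Finset.subset_union_right, ?_⟩
        simp [hbad, ht]; omega
    · obtain ⟨r, hr⟩ := hRne
      rcases IH C (hC.1.trans Finset.sdiff_subset)
        (fun h => (Finset.mem_sdiff.1 (hC.1 (h ▸ hR hr : r ∈ C))).2 hr) hC.2.1 with
        ⟨D, hD, hcard⟩ | h
      · refine ⟨D, hD.mono Finset.subset_union_right, ?_⟩
        simp [hbad]; omega
      · exact absurd h hbad
  choose! E hE hEcard using key
  refine ⟨D₀ ∪ (G.comps (S \ R)).biUnion E, ?_, ?_⟩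
  · intro u hu a ha b hb h1 h2 h3 hua hub
    have h1' := h1.mono Finset.subset_union_left
    have h2' := h2.mono Finset.subset_union_left
    have h3' := h3.mono Finset.subset_union_left
    -- By `hsep` no edge between undominated vertices crosses the boundary of R, so `u` and its
    -- undominated neighbours lie together in R or in one component.
    by_cases huR : u ∈ R
    · have haR : a ∈ R := by by_contra h; exact hsep u huR a ha h h1' h2' hua
      have hbR : b ∈ R := by by_contra h; exact hsep u huR b hb h h1' h3' hub
      exact hiso u huR a haR b hbR h1' h2' h3' hua hub
    · have haR : a ∉ R := fun h => hsep a h u hu huR h2' h1' hua.symm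
      have hbR : b ∉ R := fun h => hsep b h u hu huR h3' h1' hub.symm
      obtain ⟨C, hC, huC⟩ := exists_isComp (G := G) (Finset.mem_sdiff.2 ⟨hu, huR⟩)
      have hsub : D₀ ∪ E C ⊆ D₀ ∪ (G.comps (S \ R)).biUnion E :=
        Finset.union_subset_union_right (Finset.subset_biUnion_of_mem E (mem_comps.2 hC))
      exact hE C (mem_comps.2 hC) u huC a (hC.2.2 u huC a (Finset.mem_sdiff.2 ⟨ha, haR⟩) hua) b
        (hC.2.2 u huC b (Finset.mem_sdiff.2 ⟨hb, hbR⟩) hub)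
        (h1.mono hsub) (h2.mono hsub) (h3.mono hsub) hua hub
  · have h1 := Finset.sum_le_sum hEcard
    rw [Finset.sum_add_distrib, Finset.sum_add_distrib, ← Finset.mul_sum, ← Finset.mul_sum,
      ← card_eq_sum_comps, ← Finset.card_filter, ← Finset.card_filter] at h1
    have h2 := Finset.card_union_le D₀ ((G.comps (S \ R)).biUnion E)
    have h3 : ((G.comps (S \ R)).biUnion E).card ≤ ∑ C ∈ G.comps (S \ R), (E C).card :=
      Finset.card_biUnion_le
    have h4 := Finset.card_sdiff_add_card_eq_card hR
    omega

end

/-! ### Vertices of degree at least three in a minimal counterexample -/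

section

/-- The neighbours of `v` in `S`. -/
noncomputable def nbrs {V : Type*} (G : SimpleGraph V) (S : Finset V) (v : V) : Finset V :=
  S.filter (G.Adj v)

/-- The closed neighbourhood of `v` in `S`. -/
noncomputable def cnbrs {V : Type*} (G : SimpleGraph V) (S : Finset V) (v : V) : Finset V :=
  insert v (G.nbrs S v)

/-- The bad components of `S` minus the closed neighbourhood of `v`. -/
noncomputable def badComps {V : Type*} (G : SimpleGraph V) (S : Finset V) (v : V) :
    Finset (Finset V) :=
  (G.comps (S \ G.cnbrs S v)).filter G.Bad

/-- `x` has a neighbour in `C`. -/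
def Meets {V : Type*} (G : SimpleGraph V) (x : V) (C : Finset V) : Prop :=
  ∃ c ∈ C, G.Adj x c

/-- A smallest connected set that is neither good nor bad. -/
structure IsMinCounterexample {V : Type*} (G : SimpleGraph V) (S : Finset V) : Prop where
  conn : G.IsConn S
  ih : ∀ T ⊆ S, T ≠ S → G.IsConn T → G.Good T ∨ G.Bad T
  not_good : ¬ G.Good S

/-- `G` has no induced 5-cycle. -/
def NoInducedC5 {V : Type*} (G : SimpleGraph V) : Prop :=
  ∀ a b c d e, G.Adj a b → G.Adj b c → G.Adj c d → G.Adj d e → G.Adj e a →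
    ¬ G.Adj a c → ¬ G.Adj a d → ¬ G.Adj b d → ¬ G.Adj b e → ¬ G.Adj c e → False

/-- `G` has no induced 6-cycle. -/
def NoInducedC6 {V : Type*} (G : SimpleGraph V) : Prop :=
  ∀ a b c d e f, G.Adj a b → G.Adj b c → G.Adj c d → G.Adj d e → G.Adj e f → G.Adj f a →
    ¬ G.Adj a c → ¬ G.Adj a d → ¬ G.Adj a e → ¬ G.Adj b d → ¬ G.Adj b e → ¬ G.Adj b f →
    ¬ G.Adj c e → ¬ G.Adj c f → ¬ G.Adj d f → False

variable {V : Type*} {G : SimpleGraph V} {S : Finset V}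

theorem mem_nbrs {v x : V} : x ∈ G.nbrs S v ↔ x ∈ S ∧ G.Adj v x := by
  simp [nbrs]

theorem mem_cnbrs {v x : V} : x ∈ G.cnbrs S v ↔ x = v ∨ x ∈ S ∧ G.Adj v x := by
  simp [cnbrs, nbrs]

theorem mem_badComps {v : V} {C : Finset V} :
    C ∈ G.badComps S v ↔ G.IsComp (S \ G.cnbrs S v) C ∧ G.Bad C := by
  simp [badComps, mem_comps]

theorem card_cnbrs (v : V) : (G.cnbrs S v).card = (G.nbrs S v).card + 1 := by
  rw [cnbrs, Finset.card_insert_of_notMem (by simp [mem_nbrs])]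

theorem IsConn.exists_adj {H : Finset V} (hH : G.IsConn H) (h : 2 ≤ H.card) {p : V} (hp : p ∈ H) :
    ∃ b ∈ H, G.Adj p b := by
  by_contra! hcon
  have := hH.2 {p} (by simpa using hp) (by simp) (by
    intro a ha b hb hab
    rw [Finset.mem_singleton] at ha
    subst ha
    exact absurd hab (hcon b hb))
  rw [← this] at h
  simp at h

/-- In a connected 3-set any two nonadjacent vertices have a common neighbour. -/
theorem IsConn.exists_common {H : Finset V} (hH : G.IsConn H) (h : H.card = 3) {p q : V}
    (hp : p ∈ H) (hq : q ∈ H) (hpq : p ≠ q) (hadj : ¬ G.Adj p q) :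
    ∃ r ∈ H, G.Adj p r ∧ G.Adj r q := by
  obtain ⟨b, hb, hpb⟩ := hH.exists_adj (by omega) hp
  obtain ⟨c, hc, hqc⟩ := hH.exists_adj (by omega) hq
  by_cases hbc : b = c
  · exact ⟨b, hb, hpb, hbc ▸ hqc.symm⟩
  · exfalso
    have hbq : b ≠ q := fun h => hadj (h ▸ hpb)
    have hcp : p ≠ c := fun h => hadj (h ▸ hqc).symm
    have hsub : ({p, q, b, c} : Finset V) ⊆ H := by
      simp only [Finset.insert_subset_iff, Finset.singleton_subset_iff]
      exact ⟨hp, hq, hb, hc⟩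
    have := Finset.card_le_card hsub
    rw [Finset.card_insert_of_notMem (by simp [hpq, hpb.ne, hcp]),
      Finset.card_insert_of_notMem (by simp [hbq.symm, hqc.ne]), Finset.card_pair hbc] at this
    omega

/-- A component of the rest has a neighbour in the removed set. -/
theorem IsConn.exists_adj_of_isComp (hS : G.IsConn S) {R C : Finset V} (hR : R ⊆ S)
    (hRne : R.Nonempty) (hC : G.IsComp (S \ R) C) : ∃ r ∈ R, G.Meets r C := by
  by_contra! hcon
  have := hS.2 C (hC.1.trans Finset.sdiff_subset) hC.2.1.1 (by
    intro a ha b hb hab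
    refine hC.2.2 a ha b (Finset.mem_sdiff.2 ⟨hb, fun hbR => hcon b hbR ⟨a, ha, hab.symm⟩⟩) hab)
  obtain ⟨r, hr⟩ := hRne
  have h1 : r ∈ C := this ▸ hR hr
  exact (Finset.mem_sdiff.1 (hC.1 h1)).2 hr

theorem cnbrs_subset {v : V} (hv : v ∈ S) : G.cnbrs S v ⊆ S := by
  intro x hx
  rcases mem_cnbrs.1 hx with rfl | h
  exacts [hv, h.1]

theorem IsComp.not_adj_center {v : V} {H : Finset V} (hH : G.IsComp (S \ G.cnbrs S v) H) {c : V}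
    (hc : c ∈ H) : ¬ G.Adj v c := fun h =>
  (Finset.mem_sdiff.1 (hH.1 hc)).2 (mem_cnbrs.2 (Or.inr ⟨(Finset.mem_sdiff.1 (hH.1 hc)).1, h⟩))

theorem IsComp.mem_left {T R H : Finset V} (hH : G.IsComp (T \ R) H) {c : V}
    (hc : c ∈ H) : c ∈ T := (Finset.mem_sdiff.1 (hH.1 hc)).1

theorem IsComp.notMem_right {T R H : Finset V} (hH : G.IsComp (T \ R) H) {c : V}
    (hc : c ∈ H) : c ∉ R := (Finset.mem_sdiff.1 (hH.1 hc)).2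

theorem IsComp.ne_center {v : V} {H : Finset V} (hH : G.IsComp (S \ G.cnbrs S v) H) {c : V}
    (hc : c ∈ H) : c ≠ v := fun h => hH.notMem_right hc (mem_cnbrs.2 (Or.inl h))

/-- No single vertex removal creates a bad component. -/
theorem IsMinCounterexample.not_bad_of_erase (M : G.IsMinCounterexample S) {x : V} (hx : x ∈ S)
    {C : Finset V} (hC : G.IsComp (S \ {x}) C) : ¬ G.Bad C := by
  intro hbad
  -- By connectivity `x` touches every component, so one bad component already balances the budget:
  -- 4 ≤ 1 + 3.
  have ht : ∀ K, G.IsComp (S \ {x}) K → G.Touches {x} K := fun K hK => by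
    exact M.conn.exists_adj_of_isComp (by simpa using hx) (by simp) hK
  refine M.not_good (good_of_partial (R := {x}) (D₀ := {x}) M.ih (by simpa using hx) (by simp)
    ?_ ?_ ?_)
  · intro u hu a _ b _ h
    exact absurd hu h.1
  · intro r hr t _ _ h
    exact absurd hr h.1
  · have h1 : ((G.comps (S \ {x})).filter fun C => G.Bad C ∧ ¬ G.Touches {x} C) = ∅ :=
      Finset.filter_eq_empty_iff.2 fun K hK h => h.2 (ht K (mem_comps.1 hK))
    have h2 : 0 < ((G.comps (S \ {x})).filter fun C => G.Bad C ∧ G.Touches {x} C).card :=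
      Finset.card_pos.2 ⟨C, Finset.mem_filter.2 ⟨mem_comps.2 hC, hbad, ht C hC⟩⟩
    rw [h1]
    simp only [Finset.card_singleton, Finset.card_empty]
    omega

/-- Every bad component of `S - N[v]` has two neighbours in `N(v)`. -/
theorem IsMinCounterexample.two_le_touching (M : G.IsMinCounterexample S) {v : V} (hv : v ∈ S)
    {H : Finset V} (hH : H ∈ G.badComps S v) :
    2 ≤ ((G.nbrs S v).filter fun x => G.Meets x H).card := by
  obtain ⟨hH, hbad⟩ := mem_badComps.1 hH
  by_contra! hlt
  obtain ⟨r, hr, c, hc, hrc⟩ :=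
    M.conn.exists_adj_of_isComp (cnbrs_subset hv) ⟨v, by simp [mem_cnbrs]⟩ hH
  rcases mem_cnbrs.1 hr with rfl | hr'
  · exact hH.not_adj_center hc hrc
  · have huniq := Finset.card_le_one.1 (Nat.le_of_lt_succ hlt) r
      (Finset.mem_filter.2 ⟨mem_nbrs.2 hr', c, hc, hrc⟩)
    -- If `r` is the only neighbour of `v` touching H, then H is also a component of S - r.
    refine M.not_bad_of_erase hr'.1 (C := H) ⟨?_, hH.2.1, ?_⟩ hbad
    · intro y hy
      rw [Finset.mem_sdiff, Finset.mem_singleton]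
      exact ⟨hH.mem_left hy, fun h => hH.notMem_right hy (h ▸ hr)⟩
    · intro a ha b hb hab
      rw [Finset.mem_sdiff, Finset.mem_singleton] at hb
      refine hH.2.2 a ha b (Finset.mem_sdiff.2 ⟨hb.1, fun hbc => ?_⟩) hab
      rcases mem_cnbrs.1 hbc with rfl | hb'
      · exact hH.not_adj_center ha hab.symm
      · exact hb.2 (huniq b (Finset.mem_filter.2 ⟨mem_nbrs.2 hb', a, ha, hab.symm⟩)).symm

/-- A hitting-set count for a hypergraph `B` on `N` with edges of size at least two. -/
theorem hitting_count {α β : Type*} (N : Finset α) (B : Finset β) (r : α → β → Prop)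
    (hd : 3 ≤ N.card) (h2 : ∀ C ∈ B, 2 ≤ (N.filter (r · C)).card)
    (hX : ∀ X ⊆ N, N.card + 1 + 3 * (B.filter fun C => ∃ x ∈ X, r x C).card <
      4 * (X.card + 1) + (B.filter fun C => ¬ ∃ x ∈ X, r x C).card) :
    N.card ≤ B.card + 2 ∧ ∀ x ∈ N, (B.filter (r x)).card ≤ 1 := by
  have hX0 := hX ∅ (by simp)
  simp only [Finset.notMem_empty, false_and, exists_false, not_false_eq_true, Finset.filter_false,
    Finset.filter_true, Finset.card_empty] at hX0
  refine ⟨by omega, ?_⟩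
  -- A largest X that hits at least 2|X| edges. By maximality every further vertex hits at most one
  -- of the edges U still unhit.
  obtain ⟨X, hXm, hmax⟩ := Finset.exists_max_image
    (N.powerset.filter fun X => 2 * X.card ≤ (B.filter fun C => ∃ x ∈ X, r x C).card) Finset.card
    ⟨∅, by simp⟩
  simp only [Finset.mem_filter, Finset.mem_powerset] at hXm hmax
  obtain ⟨hXN, hXc⟩ := hXm
  set U := B.filter fun C => ¬ ∃ x ∈ X, r x C with hU
  have hsplit : (B.filter fun C => ∃ x ∈ X, r x C).card + U.card = B.card :=
    Finset.card_filter_add_card_filter_not _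
  have hone : ∀ x ∈ N \ X, (U.filter (r x)).card ≤ 1 := by
    intro x hx
    rw [Finset.mem_sdiff] at hx
    by_contra! hgt
    have hsub : (B.filter fun C => ∃ x ∈ X, r x C) ∪ U.filter (r x) ⊆
        B.filter fun C => ∃ y ∈ insert x X, r y C := by
      intro C hC
      rw [Finset.mem_union, Finset.mem_filter, Finset.mem_filter, hU, Finset.mem_filter] at hC
      rw [Finset.mem_filter]
      rcases hC with ⟨hC, y, hy, hr⟩ | ⟨⟨hC, -⟩, hr⟩
      · exact ⟨hC, y, Finset.mem_insert_of_mem hy, hr⟩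
      · exact ⟨hC, x, Finset.mem_insert_self _ _, hr⟩
    have hdisj : Disjoint (B.filter fun C => ∃ x ∈ X, r x C) (U.filter (r x)) :=
      Finset.disjoint_left.2 fun C hC hC' =>
        (Finset.mem_filter.1 (Finset.mem_filter.1 hC').1).2 (Finset.mem_filter.1 hC).2
    have hcard := Finset.card_le_card hsub
    rw [Finset.card_union_of_disjoint hdisj] at hcard
    have hins := Finset.card_insert_of_notMem hx.2
    have := hmax (insert x X) ⟨Finset.insert_subset hx.1 hXN, by omega⟩
    omega
  -- Double counting: an unhit edge has all its vertices, at least two, outside X.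
  have hdouble : 2 * U.card ≤ N.card - X.card := by
    have h1 : ∀ C ∈ U, 2 ≤ ((N \ X).filter (r · C)).card := by
      intro C hC
      rw [hU, Finset.mem_filter] at hC
      refine (h2 C hC.1).trans (Finset.card_le_card fun x hx => ?_)
      rw [Finset.mem_filter] at hx ⊢
      exact ⟨Finset.mem_sdiff.2 ⟨hx.1, fun h => hC.2 ⟨x, h, hx.2⟩⟩, hx.2⟩
    have h3 := Finset.card_mul_le_card_mul' (s := N \ X) (t := U) r (m := 1) (n := 2)
      (fun C hC => by simpa [Finset.bipartiteBelow] using h1 C hC)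
      (fun x hx => by simpa [Finset.bipartiteAbove] using hone x hx)
    rw [Finset.card_sdiff_of_subset hXN] at h3
    omega
  have hpick : ∀ C ∈ U, ∃ x, x ∈ N ∧ r x C := by
    intro C hC
    obtain ⟨x, hx⟩ := Finset.card_pos.1 (lt_of_lt_of_le two_pos (h2 C (Finset.mem_filter.1 hC).1))
    exact ⟨x, Finset.mem_filter.1 hx⟩
  obtain ⟨x₀, -⟩ := Finset.card_pos.1 (by omega : 0 < N.card)
  have : Nonempty α := ⟨x₀⟩
  choose! e heN her using hpick
  -- One extra vertex per unhit edge makes everything hit. Together with |B| ≥ 2|X| + |U| and |N| ≥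
  -- |X| + 2|U| the hypothesis then gives 3|X| + |U| < 3, so X is empty.
  have hfin := hX (X ∪ U.image e) (Finset.union_subset hXN fun x hx => by
    obtain ⟨C, hC, rfl⟩ := Finset.mem_image.1 hx
    exact heN C hC)
  have hall : ∀ C ∈ B, ∃ x ∈ X ∪ U.image e, r x C := by
    intro C hC
    by_cases h : ∃ x ∈ X, r x C
    · obtain ⟨x, hx, hr⟩ := h
      exact ⟨x, Finset.mem_union_left _ hx, hr⟩
    · have hCU : C ∈ U := Finset.mem_filter.2 ⟨hC, h⟩
      exact ⟨e C, Finset.mem_union_right _ (Finset.mem_image_of_mem e hCU), her C hCU⟩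
  rw [Finset.filter_true_of_mem hall,
    Finset.filter_false_of_mem (fun C hC h => h (hall C hC)), Finset.card_empty] at hfin
  have hu1 := Finset.card_union_le X (U.image e)
  have hu2 : (U.image e).card ≤ U.card := Finset.card_image_le
  have hXN' := Finset.card_le_card hXN
  have hX0 : X.card = 0 := by omega
  intro x hx
  -- A vertex hitting two edges would be an admissible singleton, larger than the empty maximum.
  by_contra! hgt
  have := hmax {x} ⟨by simpa using hx, by
    simp only [Finset.mem_singleton, exists_eq_left, Finset.card_singleton, mul_one]
    exact hgt⟩
  rw [Finset.card_singleton] at this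
  omega

/-- Around a vertex of degree at least three, there are many bad components, and no neighbour
touches two of them. -/
theorem IsMinCounterexample.badComps_count (M : G.IsMinCounterexample S) {v : V} (hv : v ∈ S)
    (hd : 3 ≤ (G.nbrs S v).card) :
    (G.nbrs S v).card ≤ (G.badComps S v).card + 2 ∧
      ∀ x ∈ G.nbrs S v, ((G.badComps S v).filter fun C => G.Meets x C).card ≤ 1 := by
  -- The inequality required for X is the failure of the budget for R = N[v] and D₀ = {v} ∪ X.
  refine hitting_count _ _ (fun x C => G.Meets x C) hd
    (fun C hC => M.two_le_touching hv hC) fun X hX => ?_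
  by_contra hle
  rw [not_lt] at hle
  have hR : ∀ r ∈ G.cnbrs S v, ¬ G.Undominated (insert v X) r := by
    rintro r hr ⟨h1, h2⟩
    rcases mem_cnbrs.1 hr with rfl | h
    · simp at h1
    · exact h2 v (by simp) h.2
  refine M.not_good (good_of_partial (R := G.cnbrs S v) (D₀ := insert v X) M.ih (cnbrs_subset hv)
    ⟨v, by simp [mem_cnbrs]⟩ (fun u hu _ _ _ _ h => absurd h (hR u hu))
    (fun r hr t _ _ h => absurd h (hR r hr)) ?_)
  have ht : ∀ C ∈ G.comps (S \ G.cnbrs S v),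
      (G.Touches (insert v X) C ↔ ∃ x ∈ X, G.Meets x C) := by
    intro C hC
    rw [mem_comps] at hC
    constructor
    · rintro ⟨d, hd, c, hc, hdc⟩
      rcases Finset.mem_insert.1 hd with rfl | hd
      · exact absurd hdc (hC.not_adj_center hc)
      · exact ⟨d, hd, c, hc, hdc⟩
    · rintro ⟨d, hd, c, hc, hdc⟩
      exact ⟨d, Finset.mem_insert_of_mem hd, c, hc, hdc⟩
  have e1 : ((G.comps (S \ G.cnbrs S v)).filter fun C =>
      G.Bad C ∧ ¬ G.Touches (insert v X) C) =
      (G.badComps S v).filter fun C => ¬ ∃ x ∈ X, G.Meets x C := by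
    rw [badComps, Finset.filter_filter]
    exact Finset.filter_congr fun C hC => by rw [ht C hC]
  have e2 : ((G.comps (S \ G.cnbrs S v)).filter fun C =>
      G.Bad C ∧ G.Touches (insert v X) C) =
      (G.badComps S v).filter fun C => ∃ x ∈ X, G.Meets x C := by
    rw [badComps, Finset.filter_filter]
    exact Finset.filter_congr fun C hC => by rw [ht C hC]
  have hc : (insert v X).card ≤ X.card + 1 := Finset.card_insert_le _ _
  rw [e1, e2, card_cnbrs]
  omega

/-- Nonadjacent neighbours of `v` without common neighbour on a cycle avoiding `N[v]` do not
have consecutive neighbours on it. -/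
theorem CycleOn.not_adj_succ {n : ℕ} [NeZero n] {f : Fin n → V} (hf : G.CycleOn f)
    (h5 : G.NoInducedC5) {v x y : V} (hvf : ∀ i, ¬ G.Adj v (f i)) (hvx : G.Adj v x)
    (hvy : G.Adj v y) (hxy : ¬ G.Adj x y) (hno : ∀ i, ¬ (G.Adj x (f i) ∧ G.Adj y (f i))) {k : Fin n}
    (hx : G.Adj x (f k)) (hy : G.Adj y (f (k + 1))) : False := by
  refine h5 (f k) (f (k + 1)) y v x ((hf.2 _ _).2 (Or.inl rfl)) hy.symm hvy.symm hvx hx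
    ?_ ?_ ?_ ?_ ?_
  · exact fun h => hno _ ⟨hx, h.symm⟩
  · exact fun h => hvf _ h.symm
  · exact fun h => hvf _ h.symm
  · exact fun h => hno _ ⟨h.symm, hy⟩
  · exact fun h => hxy h.symm

/-- Attachments at distance two would close an induced 6-cycle through `v`; its cross chords are
excluded by the distance-one case. -/
theorem CycleOn.not_adj_add_two {n : ℕ} [NeZero n] {f : Fin n → V} (hf : G.CycleOn f)
    (h5 : G.NoInducedC5) (h6 : G.NoInducedC6) {v x y : V} (hvf : ∀ i, ¬ G.Adj v (f i))
    (hvx : G.Adj v x) (hvy : G.Adj v y) (hxy : ¬ G.Adj x y)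
    (hno : ∀ i, ¬ (G.Adj x (f i) ∧ G.Adj y (f i))) {k : Fin n} (hn : ¬ G.Adj (f k) (f (k + 1 + 1)))
    (hx : G.Adj x (f k)) (hy : G.Adj y (f (k + 1 + 1))) : False := by
  refine h6 (f k) (f (k + 1)) (f (k + 1 + 1)) y v x ((hf.2 _ _).2 (Or.inl rfl))
    ((hf.2 _ _).2 (Or.inl rfl)) hy.symm hvy.symm hvx hx hn ?_ ?_ ?_ ?_ ?_ ?_ ?_ ?_
  · exact fun h => hno _ ⟨hx, h.symm⟩
  · exact fun h => hvf _ h.symm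
  · exact fun h => hf.not_adj_succ h5 hvf hvx hvy hxy hno hx h.symm
  · exact fun h => hvf _ h.symm
  · exact fun h => hf.not_adj_succ h5 hvf hvx hvy hxy hno h.symm hy
  · exact fun h => hvf _ h.symm
  · exact fun h => hno _ ⟨h.symm, hy⟩
  · exact fun h => hxy h.symm

/-- Nonadjacent neighbours of `v` that both touch a connected 3-set outside `N[v]` have a common
neighbour in it. -/
theorem IsConn.exists_common_adj {H : Finset V} (hH : G.IsConn H) (h : H.card = 3)
    (h5 : G.NoInducedC5) (h6 : G.NoInducedC6) {v x y : V} (hvH : ∀ z ∈ H, ¬ G.Adj v z)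
    (hvx : G.Adj v x) (hvy : G.Adj v y) (hxy : ¬ G.Adj x y) {p q : V} (hp : p ∈ H) (hq : q ∈ H)
    (hxp : G.Adj x p) (hyq : G.Adj y q) : ∃ z ∈ H, G.Adj x z ∧ G.Adj y z := by
  by_contra! hno
  have hpq : p ≠ q := fun h => hno p hp hxp (h ▸ hyq)
  have step : ∀ p ∈ H, ∀ q ∈ H, G.Adj x p → G.Adj y q → ¬ G.Adj p q := by
    intro p hp q hq hxp hyq hpq
    exact h5 p q y v x hpq hyq.symm hvy.symm hvx hxp (fun h => hno p hp hxp h.symm)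
      (fun h => hvH p hp h.symm) (fun h => hvH q hq h.symm) (fun h => hno q hq h.symm hyq)
      (fun h => hxy h.symm)
  obtain ⟨r, hr, hpr, hrq⟩ := hH.exists_common h hp hq hpq (step p hp q hq hxp hyq)
  exact h6 p r q y v x hpr hrq hyq.symm hvy.symm hvx hxp (step p hp q hq hxp hyq)
    (fun h => hno p hp hxp h.symm) (fun h => hvH p hp h.symm)
    (fun h => step p hp r hr hxp h.symm hpr) (fun h => hvH r hr h.symm)
    (fun h => step r hr q hq h.symm hyq hrq) (fun h => hvH q hq h.symm)
    (fun h => hno q hq h.symm hyq) (fun h => hxy h.symm)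

/-- A bad set outside `N[v]` can be isolated optimally so that two given nonadjacent neighbours of
`v` become dominated. -/
theorem Bad.exists_isolates_dominating {H : Finset V} (hH : G.Bad H)
    (h5 : G.NoInducedC5) (h6 : G.NoInducedC6) {v x y : V} (hvH : ∀ z ∈ H, ¬ G.Adj v z)
    (hvx : G.Adj v x) (hvy : G.Adj v y) (hxy : ¬ G.Adj x y) {p q : V} (hp : p ∈ H) (hq : q ∈ H)
    (hxp : G.Adj x p) (hyq : G.Adj y q) :
    ∃ D, G.Isolates D H ∧ 4 * D.card ≤ H.card + 1 ∧ ¬ G.Undominated D x ∧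
      ¬ G.Undominated D y := by
  rcases hH with ⟨hcard, hconn⟩ | ⟨f, hf, rfl⟩ | ⟨f, hf, rfl⟩
  · obtain ⟨z, hz, hxz, hyz⟩ := hconn.exists_common_adj hcard h5 h6 hvH hvx hvy hxy hp hq hxp hyq
    refine ⟨{z}, isolates_of_card_le_two (T := H.erase z) (by rw [Finset.card_erase_of_mem hz]; omega)
      fun u hu h => Finset.mem_erase.2 ⟨fun h' => h.1 (by simp [h']), hu⟩, by simp [hcard],
      fun h => h.2 z (by simp) hxz.symm, fun h => h.2 z (by simp) hyz.symm⟩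
  · by_cases hno : ∃ z ∈ Finset.univ.image f, G.Adj x z ∧ G.Adj y z
    · obtain ⟨z, hz, hxz, hyz⟩ := hno
      obtain ⟨g, hg, hfg, rfl⟩ := hf.exists_rotate hz
      rw [hfg]
      refine ⟨{g 0, g 3}, hg.isolates_image {0, 3} (by simp) (by decide), ?_,
        fun h => h.2 (g 0) (by simp) hxz.symm, fun h => h.2 (g 0) (by simp) hyz.symm⟩
      rw [hg.card, Finset.card_pair (hg.1.ne (by decide))]
    · obtain ⟨g, hg, hfg, rfl⟩ := hf.exists_rotate hp
      rw [hfg] at hq hno hvH ⊢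
      simp only [Finset.mem_image, Finset.mem_univ, true_and, forall_exists_index,
        forall_apply_eq_imp_iff] at hq hvH
      obtain ⟨k, rfl⟩ := hq
      have hno1 : ∀ i, ¬ (G.Adj x (g i) ∧ G.Adj y (g i)) := fun i hi => hno ⟨g i, by simp, hi⟩
      have hno2 : ∀ i, ¬ (G.Adj y (g i) ∧ G.Adj x (g i)) := fun i hi => hno1 i hi.symm
      have hyx : ¬ G.Adj y x := fun h => hxy h.symm
      have hch : ∀ k : Fin 7, ¬ G.Adj (g k) (g (k + 1 + 1)) := fun k => by
        rw [hg.2]; revert k; decide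
      -- Without a common neighbour, the attachments on the 7-cycle are at distance three, and such
      -- a pair isolates it.
      have k0 : k ≠ 0 := by rintro rfl; exact hno1 0 ⟨hxp, hyq⟩
      have k1 : k ≠ 1 := by
        rintro rfl; exact hg.not_adj_succ h5 hvH hvx hvy hxy hno1 hxp hyq
      have k2 : k ≠ 2 := by
        rintro rfl; exact hg.not_adj_add_two h5 h6 hvH hvx hvy hxy hno1 (hch 0) hxp hyq
      have k6 : k ≠ 6 := by
        rintro rfl; exact hg.not_adj_succ h5 hvH hvy hvx hyx hno2 hyq hxp
      have k5 : k ≠ 5 := by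
        rintro rfl; exact hg.not_adj_add_two h5 h6 hvH hvy hvx hyx hno2 (hch 5) hyq hxp
      refine ⟨{g 0, g k}, hg.isolates_image {0, k} (by simp)
        (by clear hyq; revert k; decide), ?_,
        fun h => h.2 (g 0) (by simp) hxp.symm, fun h => h.2 (g k) (by simp) hyq.symm⟩
      rw [hg.card, Finset.card_pair (hg.1.ne k0.symm)]
  · obtain ⟨g, hg, hfg, rfl⟩ := hf.exists_rotate hp
    rw [hfg] at hq ⊢
    simp only [Finset.mem_image, Finset.mem_univ, true_and] at hq
    obtain ⟨k, rfl⟩ := hq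
    by_cases hk : k = 0
    · subst hk
      refine ⟨{g 0, g 4, g 7}, hg.isolates_image {0, 4, 7} (by simp) (by decide), ?_,
        fun h => h.2 (g 0) (by simp) hxp.symm, fun h => h.2 (g 0) (by simp) hyq.symm⟩
      rw [hg.card]
      have : ({g 0, g 4, g 7} : Finset V).card ≤ 3 := Finset.card_le_three
      omega
    -- Any two vertices of an 11-cycle extend to an isolating triple, so no forbidden cycle is
    -- needed here.
    have hc : ∀ k : Fin 11, k ≠ 0 → ∃ c : Fin 11, ∀ i : Fin 11, ∃ l ∈ ({0, k, c} : Finset (Fin 11)),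
        l + 1 = i ∨ l = i ∨ l = i + 1 ∨ l = i + 1 + 1 ∨ l = i + 1 + 1 + 1 := by decide
    obtain ⟨c, hc⟩ := hc k hk
    refine ⟨{g 0, g k, g c}, hg.isolates_image {0, k, c} (by simp) hc, ?_,
      fun h => h.2 (g 0) (by simp) hxp.symm, fun h => h.2 (g k) (by simp) hyq.symm⟩
    rw [hg.card]
    have : ({g 0, g k, g c} : Finset V).card ≤ 3 := Finset.card_le_three
    omega

/-- A bad component of `S - N[v]` is not touched by exactly two neighbours of `v`, provided these
touch no other one. -/
theorem IsMinCounterexample.false_of_pair (M : G.IsMinCounterexample S) (h5 : G.NoInducedC5)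
    (h6 : G.NoInducedC6) {v x y : V} (hv : v ∈ S) (hx : x ∈ G.nbrs S v) (hy : y ∈ G.nbrs S v)
    (hxy : x ≠ y) {H : Finset V} (hH : H ∈ G.badComps S v) (hxH : G.Meets x H)
    (hyH : G.Meets y H)
    (honly : ∀ z ∈ G.nbrs S v, (G.Meets z H) → z = x ∨ z = y)
    (huniq : ∀ z ∈ G.nbrs S v,
      ((G.badComps S v).filter fun C => G.Meets z C).card ≤ 1) : False := by
  have hHm := hH
  obtain ⟨hH, hbad⟩ := mem_badComps.1 hH
  obtain ⟨p, hp, hxp⟩ := hxH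
  obtain ⟨q, hq, hyq⟩ := hyH
  have hx' := mem_nbrs.1 hx
  have hy' := mem_nbrs.1 hy
  have hvH : ∀ z ∈ H, ¬ G.Adj v z := fun z hz => hH.not_adj_center hz
  obtain ⟨D, hD, hDc, hDx, hDy⟩ : ∃ D, G.Isolates D H ∧ 4 * D.card ≤ H.card + 1 ∧
      ¬ G.Undominated D x ∧ ¬ G.Undominated D y := by
    -- If x and y are adjacent, choosing x dominates both, and the vertex it saves inside H pays for
    -- it.
    by_cases hadj : G.Adj x y
    · obtain ⟨D, hD, hDc⟩ := hbad.exists_isolates_of_adj hp hxp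
      have := Finset.card_insert_le x D
      exact ⟨insert x D, hD, by omega, fun h => h.1 (by simp), fun h => h.2 x (by simp) hadj⟩
    · exact hbad.exists_isolates_dominating h5 h6 hvH hx'.2 hy'.2 hadj hp hq hxp hyq
  have hxc : x ∈ G.cnbrs S v := mem_cnbrs.2 (Or.inr hx')
  have hyc : y ∈ G.cnbrs S v := mem_cnbrs.2 (Or.inr hy')
  have hxnH : x ∉ H := fun h => hH.notMem_right h hxc
  have hynH : y ∉ H := fun h => hH.notMem_right h hyc
  have hvnH : v ∉ H := fun h => hH.ne_center h rfl
  have hmemR : ∀ z, z ∈ insert x (insert y H) ↔ z = x ∨ z = y ∨ z ∈ H := by simp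
  have hHiff : ∀ a ∈ H, ∀ b ∈ S, G.Adj a b → b ∈ insert x (insert y H) := by
    intro a ha b hb hab
    rw [hmemR]
    by_cases hbc : b ∈ G.cnbrs S v
    · rcases mem_cnbrs.1 hbc with rfl | hb'
      · exact absurd hab.symm (hvH a ha)
      · have := honly b (mem_nbrs.2 hb') ⟨a, ha, hab.symm⟩
        tauto
    · exact Or.inr (Or.inr (hH.2.2 a ha b (Finset.mem_sdiff.2 ⟨hb, hbc⟩) hab))
  refine M.not_good (good_of_partial (R := insert x (insert y H)) (D₀ := D) M.ih ?_
    ⟨x, by simp⟩ ?_ ?_ ?_)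
  · intro z hz
    rcases (hmemR z).1 hz with rfl | rfl | hz
    exacts [hx'.1, hy'.1, hH.mem_left hz]
  · refine hD.of_undominated fun u hu hund => ?_
    rcases (hmemR u).1 hu with rfl | rfl | hu
    exacts [absurd hund hDx, absurd hund hDy, hu]
  · intro r hr t ht htR hund _ hrt
    rcases (hmemR r).1 hr with rfl | rfl | hr
    exacts [hDx hund, hDy hund, htR (hHiff r hr t ht hrt)]
  · have hcard : (insert x (insert y H)).card = H.card + 2 := by
      rw [Finset.card_insert_of_notMem (by simp [hxy, hxnH]), Finset.card_insert_of_notMem hynH]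
    have hvT : v ∈ S \ insert x (insert y H) := by
      rw [Finset.mem_sdiff, hmemR]
      refine ⟨hv, ?_⟩
      rintro (rfl | rfl | h)
      exacts [hx'.2.ne rfl, hy'.2.ne rfl, hvnH h]
    -- A bad component avoiding `v` would be a bad component of S - N[v] touched by x or y, which
    -- already touch H. So at most one bad component is left, and 4|D| + 1 ≤ |H| + 2 covers it.
    have hvK : ∀ K, G.IsComp (S \ insert x (insert y H)) K → G.Bad K → v ∈ K := by
      intro K hK hKbad
      by_contra hvK
      have hKc : ∀ u ∈ K, u ∉ G.cnbrs S v := by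
        intro u hu huc
        rcases mem_cnbrs.1 huc with rfl | hu'
        · exact hvK hu
        · exact hvK (hK.2.2 u hu v hvT hu'.2.symm)
      have hKb : K ∈ G.badComps S v := by
        refine mem_badComps.2 ⟨⟨fun u hu => Finset.mem_sdiff.2 ⟨hK.mem_left hu, hKc u hu⟩, hK.2.1,
          fun a ha b hb hab => hK.2.2 a ha b (Finset.mem_sdiff.2 ⟨(Finset.mem_sdiff.1 hb).1, ?_⟩) hab⟩,
          hKbad⟩
        rw [hmemR]
        rintro (rfl | rfl | h)
        · exact (Finset.mem_sdiff.1 hb).2 hxc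
        · exact (Finset.mem_sdiff.1 hb).2 hyc
        · exact hK.notMem_right ha (hHiff b h a (hK.mem_left ha) hab.symm)
      obtain ⟨z, hz⟩ := Finset.card_pos.1 (lt_of_lt_of_le two_pos (M.two_le_touching hv hKb))
      obtain ⟨hzN, c, hc, hzc⟩ := Finset.mem_filter.1 hz
      have hz' := mem_nbrs.1 hzN
      have hzc' : z ∈ G.cnbrs S v := mem_cnbrs.2 (Or.inr hz')
      have hzxy : z = x ∨ z = y := by
        by_contra hne
        refine hKc z (hK.2.2 c hc z (Finset.mem_sdiff.2 ⟨hz'.1, ?_⟩) hzc.symm) hzc'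
        rw [hmemR]
        rintro (h | h | h)
        exacts [hne (Or.inl h), hne (Or.inr h), hH.notMem_right h hzc']
      have hzH : G.Meets z H := by
        rcases hzxy with rfl | rfl
        exacts [⟨p, hp, hxp⟩, ⟨q, hq, hyq⟩]
      have := Finset.card_le_one.1 (huniq z hzN) H (Finset.mem_filter.2 ⟨hHm, hzH⟩) K
        (Finset.mem_filter.2 ⟨hKb, c, hc, hzc⟩)
      subst this
      exact hK.notMem_right hc ((hmemR c).2 (Or.inr (Or.inr hc)))
    have hle : ((G.comps (S \ insert x (insert y H))).filter fun C =>
        G.Bad C ∧ ¬ G.Touches D C).card ≤ 1 := by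
      refine Finset.card_le_one.2 fun K hK K' hK' => ?_
      rw [Finset.mem_filter, mem_comps] at hK hK'
      exact hK.1.eq_of_mem hK'.1 (hvK K hK.1 hK.2.1) (hvK K' hK'.1 hK'.2.1)
    rw [hcard]
    omega

/-- A vertex of degree at least three has degree exactly three, and its three neighbours all touch
the unique bad component of `S - N[v]`. -/
theorem IsMinCounterexample.degree_eq_three (M : G.IsMinCounterexample S) (h5 : G.NoInducedC5)
    (h6 : G.NoInducedC6) {v : V} (hv : v ∈ S) (hd : 3 ≤ (G.nbrs S v).card) :
    (G.nbrs S v).card = 3 ∧ ∃ H, G.badComps S v = {H} ∧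
      ∀ x ∈ G.nbrs S v, G.Meets x H := by
  obtain ⟨hb, huniq⟩ := M.badComps_count hv hd
  have h3 : ∀ H ∈ G.badComps S v,
      3 ≤ ((G.nbrs S v).filter fun x => G.Meets x H).card := by
    intro H hH
    by_contra! hlt
    obtain ⟨x, y, hxy, he⟩ := Finset.card_eq_two.1
      (le_antisymm (Nat.le_of_lt_succ hlt) (M.two_le_touching hv hH))
    have hmem : ∀ z, z ∈ G.nbrs S v ∧ G.Meets z H ↔ z = x ∨ z = y := by
      intro z
      have : z ∈ (G.nbrs S v).filter (fun x => G.Meets x H) ↔ z = x ∨ z = y := by rw [he]; simp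
      rwa [Finset.mem_filter] at this
    obtain ⟨hx, hxH⟩ := (hmem x).2 (Or.inl rfl)
    obtain ⟨hy, hyH⟩ := (hmem y).2 (Or.inr rfl)
    exact M.false_of_pair h5 h6 hv hx hy hxy hH hxH hyH (fun z hz hzH => (hmem z).1 ⟨hz, hzH⟩) huniq
  -- With b bad components and degree d, 3b ≤ d ≤ b + 2 and d ≥ 3 force d = 3 and b = 1.
  have hcount := Finset.card_mul_le_card_mul' (s := G.nbrs S v) (t := G.badComps S v)
    (fun x H => G.Meets x H) (m := 1) (n := 3)
    (fun C hC => h3 C hC) (fun x hx => huniq x hx)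
  have hd3 : (G.nbrs S v).card = 3 := by omega
  obtain ⟨H, hH⟩ := Finset.card_eq_one.1 (by omega : (G.badComps S v).card = 1)
  refine ⟨hd3, H, hH, fun x hx => ?_⟩
  have := Finset.eq_of_subset_of_card_le (Finset.filter_subset (fun x => G.Meets x H)
    (G.nbrs S v)) (by rw [hd3]; exact h3 H (by simp [hH]))
  rw [← this] at hx
  exact (Finset.mem_filter.1 hx).2

end

/-! ### The cubic configuration: degree counts and the case |H| = 3 -/

section

/-- A vertex `v` of degree three with neighbours `x, y, z` that all meet the only bad component
`H` of `S - N[v]`, in a set `S` of maximum degree at most three. -/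
structure CubicConfig {V : Type*} (G : SimpleGraph V) (S : Finset V) (v : V) (H : Finset V)
    (x y z : V) : Prop where
  hv : v ∈ S
  hN : ∀ w, w ∈ S ∧ G.Adj v w ↔ w = x ∨ w = y ∨ w = z
  hxy : x ≠ y
  hxz : x ≠ z
  hyz : y ≠ z
  hH : G.badComps S v = {H}
  hx : G.Meets x H
  hy : G.Meets y H
  hz : G.Meets z H
  hdeg : ∀ w ∈ S, (G.nbrs S w).card ≤ 3

variable {V : Type*} {G : SimpleGraph V} {S : Finset V}

theorem false_of_four_nbrs {w : V} (hw : (G.nbrs S w).card ≤ 3) {a b c d : V} (ha : a ∈ S)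
    (hb : b ∈ S) (hc : c ∈ S) (hd : d ∈ S) (hwa : G.Adj w a) (hwb : G.Adj w b) (hwc : G.Adj w c)
    (hwd : G.Adj w d) (hab : a ≠ b) (hac : a ≠ c) (had : a ≠ d) (hbc : b ≠ c) (hbd : b ≠ d)
    (hcd : c ≠ d) : False := by
  have hsub : ({a, b, c, d} : Finset V) ⊆ G.nbrs S w := by
    simp only [Finset.insert_subset_iff, Finset.singleton_subset_iff, mem_nbrs]
    tauto
  have := Finset.card_le_card hsub
  rw [Finset.card_insert_of_notMem (by simp [hab, hac, had]),
    Finset.card_insert_of_notMem (by simp [hbc, hbd]), Finset.card_pair hcd] at this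
  omega

namespace CubicConfig

variable {v x y z : V} {H : Finset V}

theorem swap (h : G.CubicConfig S v H x y z) : G.CubicConfig S v H y x z :=
  ⟨h.hv, fun w => by rw [h.hN]; tauto, h.hxy.symm, h.hyz, h.hxz, h.hH, h.hy, h.hx, h.hz, h.hdeg⟩

theorem rotate (h : G.CubicConfig S v H x y z) : G.CubicConfig S v H y z x :=
  ⟨h.hv, fun w => by rw [h.hN]; tauto, h.hyz, h.hxy.symm, h.hxz.symm, h.hH, h.hy, h.hz, h.hx,
    h.hdeg⟩

theorem memBad (h : G.CubicConfig S v H x y z) : G.IsComp (S \ G.cnbrs S v) H ∧ G.Bad H :=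
  mem_badComps.1 (by simp [h.hH])

theorem x_mem (h : G.CubicConfig S v H x y z) : x ∈ S := ((h.hN x).2 (Or.inl rfl)).1

theorem adj_x (h : G.CubicConfig S v H x y z) : G.Adj v x := ((h.hN x).2 (Or.inl rfl)).2

theorem mem_S (h : G.CubicConfig S v H x y z) {c : V} (hc : c ∈ H) : c ∈ S :=
  h.memBad.1.mem_left hc

theorem v_ne (h : G.CubicConfig S v H x y z) {c : V} (hc : c ∈ H) : v ≠ c :=
  (h.memBad.1.ne_center hc).symm

theorem not_adj_v (h : G.CubicConfig S v H x y z) {c : V} (hc : c ∈ H) : ¬ G.Adj v c :=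
  h.memBad.1.not_adj_center hc

theorem x_ne (h : G.CubicConfig S v H x y z) {c : V} (hc : c ∈ H) : x ≠ c := fun e =>
  h.not_adj_v hc (e ▸ h.adj_x)

/-- An optimal isolation of `H` that dominates all of `N(v)`, except possibly one vertex all of
whose other neighbours are dominated, makes `S` good. -/
theorem false_of_isolates (h : G.CubicConfig S v H x y z) (M : G.IsMinCounterexample S)
    {D : Finset V} (hD : G.Isolates D H) (hDc : 4 * D.card ≤ H.card + 1)
    (hDx : ¬ G.Undominated D x) (hDz : ¬ G.Undominated D z)
    (hDy : G.Undominated D y → ∀ w ∈ S, G.Adj y w → w ≠ v → ¬ G.Undominated D w) : False := by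
  obtain ⟨hH, hbad⟩ := h.memBad
  have hcn : ∀ w, w ∈ G.cnbrs S v ↔ w = v ∨ w = x ∨ w = y ∨ w = z := fun w => by
    rw [mem_cnbrs, h.hN]
  have hR : ∀ w, w ∈ G.cnbrs S v ∪ H ↔ w = v ∨ w = x ∨ w = y ∨ w = z ∨ w ∈ H := fun w => by
    rw [Finset.mem_union, hcn]; tauto
  have hout : ∀ r ∈ H, ∀ t ∈ S, t ∉ G.cnbrs S v ∪ H → ¬ G.Adj r t := by
    intro r hr t ht htR hrt
    rw [Finset.mem_union, not_or] at htR
    exact htR.2 (hH.2.2 r hr t (Finset.mem_sdiff.2 ⟨ht, htR.1⟩) hrt)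
  refine M.not_good (good_of_partial (R := G.cnbrs S v ∪ H) (D₀ := D) M.ih ?_ ⟨v, by simp [hR]⟩
    ?_ ?_ ?_)
  · exact Finset.union_subset (cnbrs_subset h.hv) fun c hc => h.mem_S hc
  -- `v` itself need not be dominated: an undominated `y` sees no undominated vertex except `v`, so
  -- at worst the edge vy survives apart from H.
  · have hsplit : ∀ u ∈ G.cnbrs S v ∪ H, G.Undominated D u → u = v ∨ u = y ∨ u ∈ H := by
      intro u hu hund
      rcases (hR u).1 hu with rfl | rfl | rfl | rfl | hu
      exacts [Or.inl rfl, absurd hund hDx, Or.inr (Or.inl rfl), absurd hund hDz, Or.inr (Or.inr hu)]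
    have hnbr : ∀ u ∈ H, ∀ w ∈ G.cnbrs S v ∪ H, G.Undominated D u → G.Undominated D w →
        G.Adj u w → w ∈ H := by
      intro u hu w hw hund hwund huw
      rcases hsplit w hw hwund with rfl | rfl | hw
      · exact absurd huw.symm (h.not_adj_v hu)
      · exact absurd hund (hDy hwund u (h.mem_S hu) huw.symm (h.v_ne hu).symm)
      · exact hw
    intro u hu a ha b hb h1 h2 h3 hua hub
    rcases hsplit u hu h1 with rfl | rfl | hu
    · have hy : ∀ w ∈ G.cnbrs S u ∪ H, G.Undominated D w → G.Adj u w → w = y := by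
        intro w hw hwund huw
        rcases hsplit w hw hwund with rfl | rfl | hw
        exacts [absurd rfl huw.ne, rfl, absurd huw (h.not_adj_v hw)]
      rw [hy a ha h2 hua, hy b hb h3 hub]
    · have hv : ∀ w ∈ G.cnbrs S v ∪ H, G.Undominated D w → G.Adj u w → w = v := by
        intro w hw hwund huw
        by_contra hne
        have hwS : w ∈ S := by
          rcases Finset.mem_union.1 hw with hw | hw
          exacts [cnbrs_subset h.hv hw, h.mem_S hw]
        exact hDy h1 w hwS huw hne hwund
      rw [hv a ha h2 hua, hv b hb h3 hub]
    · exact hD u hu a (hnbr u hu a ha h1 h2 hua) b (hnbr u hu b hb h1 h3 hub) h1 h2 h3 hua hub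
  · intro r hr t ht htR hund htund hrt
    rcases (hR r).1 hr with rfl | rfl | rfl | rfl | hr
    · exact htR (Finset.mem_union_left _ (mem_cnbrs.2 (Or.inr ⟨ht, hrt⟩)))
    · exact hDx hund
    · exact hDy hund t ht hrt (fun e => htR (by simp [hR, e])) htund
    · exact hDz hund
    · exact hout r hr t ht htR hrt
  · have hnone : ((G.comps (S \ (G.cnbrs S v ∪ H))).filter fun C =>
        G.Bad C ∧ ¬ G.Touches D C) = ∅ := by
      refine Finset.filter_eq_empty_iff.2 fun K hK ⟨hKbad, _⟩ => ?_
      rw [mem_comps] at hK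
      have hKb : K ∈ G.badComps S v := by
        refine mem_badComps.2 ⟨⟨fun u hu => Finset.mem_sdiff.2 ⟨hK.mem_left hu, fun hc =>
          hK.notMem_right hu (Finset.mem_union_left _ hc)⟩, hK.2.1, fun a ha b hb hab => ?_⟩, hKbad⟩
        rw [Finset.mem_sdiff] at hb
        by_cases hbH : b ∈ H
        · exact absurd hab.symm (hout b hbH a (hK.mem_left ha) (hK.notMem_right ha))
        · refine hK.2.2 a ha b (Finset.mem_sdiff.2 ⟨hb.1, ?_⟩) hab
          rw [Finset.mem_union]; tauto
      rw [h.hH, Finset.mem_singleton] at hKb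
      obtain ⟨c, hc⟩ := hK.2.1.1
      exact hK.notMem_right hc (Finset.mem_union_right _ (hKb ▸ hc))
    have hcn4 : (G.nbrs S v).card = 3 := Finset.card_eq_three.2
      ⟨x, y, z, h.hxy, h.hxz, h.hyz, by ext w; rw [mem_nbrs, h.hN]; simp⟩
    have hdisj : Disjoint (G.cnbrs S v) H :=
      Finset.disjoint_right.2 fun c hc => hH.notMem_right hc
    rw [hnone, Finset.card_union_of_disjoint hdisj, card_cnbrs, hcn4, Finset.card_empty]
    omega

/-- The vertices v, y and a neighbour in H already exhaust the degree of x. -/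
theorem not_adj_xz (h : G.CubicConfig S v H x y z) (hxy : G.Adj x y) : ¬ G.Adj x z := by
  intro hxz
  obtain ⟨c, hc, hxc⟩ := h.hx
  exact false_of_four_nbrs (h.hdeg x h.x_mem) h.hv h.rotate.x_mem h.rotate.rotate.x_mem (h.mem_S hc)
    h.adj_x.symm hxy hxz hxc h.rotate.adj_x.ne h.rotate.rotate.adj_x.ne (h.v_ne hc) h.hyz
    (h.rotate.x_ne hc) (h.rotate.rotate.x_ne hc)

theorem unique_nbr (h : G.CubicConfig S v H x y z) (hxy : G.Adj x y) {c d : V} (hc : c ∈ H)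
    (hd : d ∈ H) (hxc : G.Adj x c) (hxd : G.Adj x d) : c = d := by
  by_contra hcd
  exact false_of_four_nbrs (h.hdeg x h.x_mem) h.hv h.rotate.x_mem (h.mem_S hc) (h.mem_S hd)
    h.adj_x.symm hxy hxc hxd h.rotate.adj_x.ne (h.v_ne hc) (h.v_ne hd)
    (h.rotate.x_ne hc) (h.rotate.x_ne hd) hcd

theorem not_all_adj (h : G.CubicConfig S v H x y z) {c : V} (hc : c ∈ H) (hxc : G.Adj x c)
    (hyc : G.Adj y c) (hzc : G.Adj z c) : False := by
  have h3 := h.memBad.2.card_ge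
  obtain ⟨b, hb, hcb⟩ := h.memBad.1.2.1.exists_adj (by omega) hc
  exact false_of_four_nbrs (h.hdeg c (h.mem_S hc)) h.x_mem h.rotate.x_mem h.rotate.rotate.x_mem
    (h.mem_S hb) hxc.symm hyc.symm hzc.symm hcb h.hxy h.hxz (h.x_ne hb) h.hyz (h.rotate.x_ne hb)
    (h.rotate.rotate.x_ne hb)

/-- A vertex of `H` with two neighbours in `N(v)` has at most one in `H`. -/
theorem unique_of_two (h : G.CubicConfig S v H x y z) {c a b : V} (hc : c ∈ H) (ha : a ∈ H)
    (hb : b ∈ H) (hxc : G.Adj x c) (hyc : G.Adj y c) (hca : G.Adj c a) (hcb : G.Adj c b) :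
    a = b := by
  by_contra hab
  exact false_of_four_nbrs (h.hdeg c (h.mem_S hc)) h.x_mem h.rotate.x_mem (h.mem_S ha)
    (h.mem_S hb) hxc.symm hyc.symm hca hcb h.hxy (h.x_ne ha) (h.x_ne hb) (h.rotate.x_ne ha)
    (h.rotate.x_ne hb) hab

theorem exists_common (h : G.CubicConfig S v H x y z) (h5 : G.NoInducedC5) (h6 : G.NoInducedC6)
    (hcard : H.card = 3) (hxy : ¬ G.Adj x y) : ∃ c ∈ H, G.Adj x c ∧ G.Adj y c := by
  obtain ⟨p, hp, hxp⟩ := h.hx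
  obtain ⟨q, hq, hyq⟩ := h.hy
  exact h.memBad.1.2.1.exists_common_adj hcard h5 h6 (fun z hz => h.not_adj_v hz) h.adj_x
    h.rotate.adj_x hxy hp hq hxp hyq

theorem exists_exit (h : G.CubicConfig S v H x y z) (hcard : H.card = 3) {a b : V} (ha : a ∈ H)
    (hb : b ∈ H) : ∃ c ∈ H, c ≠ a ∧ c ≠ b ∧ (G.Adj a c ∨ G.Adj b c) := by
  by_contra! hcon
  have := h.memBad.1.2.1.2 {a, b} (by simp [Finset.insert_subset_iff, ha, hb]) (by simp) (by
    intro w hw c hc hwc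
    by_contra hcm
    simp only [Finset.mem_insert, Finset.mem_singleton, not_or] at hw hcm
    have := hcon c hc hcm.1 hcm.2
    rcases hw with rfl | rfl
    exacts [this.1 hwc, this.2 hwc])
  have h2 : ({a, b} : Finset V).card ≤ 2 := Finset.card_le_two
  rw [this] at h2
  omega

/-- The pairs x, z and y, z have distinct common neighbours a and b in H, each with only one
neighbour inside H. If a and b are adjacent, the third vertex of H is cut off; otherwise it joins
them and closes an induced 5-cycle with x and y. -/
theorem card_ne_three_of_adj (h : G.CubicConfig S v H x y z) (h5 : G.NoInducedC5)
    (h6 : G.NoInducedC6) (hxy : G.Adj x y) : H.card ≠ 3 := by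
  intro hcard
  have hxz := h.not_adj_xz hxy
  have hyz := h.swap.not_adj_xz hxy.symm
  obtain ⟨a, ha, hza, hxa⟩ :=
    h.rotate.rotate.exists_common h5 h6 hcard (fun e => hxz e.symm)
  obtain ⟨b, hb, hyb, hzb⟩ := h.rotate.exists_common h5 h6 hcard hyz
  have hab : a ≠ b := by
    rintro rfl
    exact h.not_all_adj ha hxa hyb hza
  by_cases hadj : G.Adj a b
  · obtain ⟨c, hc, hca, hcb, hac | hbc⟩ := h.exists_exit hcard ha hb
    · exact hcb (h.rotate.rotate.unique_of_two ha hc hb hza hxa hac hadj)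
    · exact hca (h.rotate.unique_of_two hb hc ha hyb hzb hbc hadj.symm)
  · obtain ⟨r, hr, har, hrb⟩ := h.memBad.1.2.1.exists_common hcard ha hb hab hadj
    exact h5 x a r b y hxa har hrb hyb.symm hxy.symm
      (fun e => har.ne (h.unique_nbr hxy ha hr hxa e))
      (fun e => hab (h.unique_nbr hxy ha hb hxa e)) hadj
      (fun e => hab (h.swap.unique_nbr hxy.symm ha hb e.symm hyb))
      (fun e => hrb.ne (h.swap.unique_nbr hxy.symm hr hb e.symm hyb))

/-- The three pairs have three distinct common neighbours, which make up H. Each has at most one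
neighbour inside H, but a connected triple has a vertex with two. -/
theorem card_ne_three_of_not_adj (h : G.CubicConfig S v H x y z) (h5 : G.NoInducedC5)
    (h6 : G.NoInducedC6) (hxy : ¬ G.Adj x y) (hyz : ¬ G.Adj y z) (hzx : ¬ G.Adj z x) :
    H.card ≠ 3 := by
  intro hcard
  obtain ⟨a, ha, hxa, hya⟩ := h.exists_common h5 h6 hcard hxy
  obtain ⟨b, hb, hyb, hzb⟩ := h.rotate.exists_common h5 h6 hcard hyz
  obtain ⟨c, hc, hzc, hxc⟩ := h.rotate.rotate.exists_common h5 h6 hcard hzx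
  have hab : a ≠ b := by rintro rfl; exact h.not_all_adj ha hxa hya hzb
  have hbc : b ≠ c := by rintro rfl; exact h.not_all_adj hb hxc hyb hzb
  have hac : a ≠ c := by rintro rfl; exact h.not_all_adj ha hxa hya hzc
  by_cases hadj : G.Adj a b
  · obtain ⟨w, hw, hwa, hwb, haw | hbw⟩ := h.exists_exit hcard ha hb
    · exact hwb (h.unique_of_two ha hw hb hxa hya haw hadj)
    · exact hwa (h.rotate.unique_of_two hb hw ha hyb hzb hbw hadj.symm)
  · obtain ⟨r, hr, har, hrb⟩ := h.memBad.1.2.1.exists_common hcard ha hb hab hadj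
    have hH : ({a, b, c} : Finset V) = H := Finset.eq_of_subset_of_card_le
      (by simp [Finset.insert_subset_iff, ha, hb, hc])
      (by rw [hcard, Finset.card_eq_three.2 ⟨a, b, c, hab, hac, hbc, rfl⟩])
    rw [← hH] at hr
    simp only [Finset.mem_insert, Finset.mem_singleton] at hr
    rcases hr with rfl | rfl | rfl
    · exact har.ne rfl
    · exact hrb.ne rfl
    · exact hab (h.rotate.rotate.unique_of_two hc ha hb hzc hxc har.symm hrb)

end CubicConfig

/-! ### The cubic configuration when H is a 7-cycle or an 11-cycle -/

/-- Indices at cyclic distance at least three. -/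
def IndexFar {n : ℕ} [NeZero n] (k l : Fin n) : Prop :=
  l ≠ k ∧ l ≠ k + 1 ∧ k ≠ l + 1 ∧ l ≠ k + 1 + 1 ∧ k ≠ l + 1 + 1

instance {n : ℕ} [NeZero n] (k l : Fin n) : Decidable (IndexFar k l) :=
  inferInstanceAs (Decidable (_ ∧ _))

/-- Three pairwise far vertices leave no three consecutive vertices of the 11-cycle undominated. -/
theorem indexFar_cover : ∀ k l : Fin 11, IndexFar 0 k → IndexFar k l → IndexFar l 0 →
    ∀ i : Fin 11, ∃ m ∈ ({0, k, l} : Finset (Fin 11)),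
      m + 1 = i ∨ m = i ∨ m = i + 1 ∨ m = i + 1 + 1 ∨ m = i + 1 + 1 + 1 := by decide

namespace CubicConfig

variable {v x y z : V} {n : ℕ} [NeZero n] {f : Fin n → V}

/-- On a cycle, each vertex has at most one neighbour in `N(v)`. -/
theorem not_common_cycle (h : G.CubicConfig S v (Finset.univ.image f) x y z) (hf : G.CycleOn f)
    (h2 : (1 + 1 : Fin n) ≠ 0) (i : Fin n) : ¬ (G.Adj x (f i) ∧ G.Adj y (f i)) := by
  rintro ⟨hx, hy⟩
  have := h.unique_of_two (c := f i) (a := f (i + 1)) (b := f (i - 1)) (by simp) (by simp) (by simp)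
    hx hy ((hf.2 _ _).2 (Or.inl rfl)) ((hf.2 _ _).2 (Or.inr (by simp)))
  have h' := hf.1 this
  apply h2
  have : i + 1 - (i - 1) = 0 := by rw [h', sub_self]
  rwa [add_sub_sub_cancel] at this

/-- Distance zero is excluded by the degree bound, distance one by an induced 5-cycle through `v`,
distance two by an induced 6-cycle. -/
theorem indexFar (h : G.CubicConfig S v (Finset.univ.image f) x y z) (hf : G.CycleOn f)
    (h5 : G.NoInducedC5) (h6 : G.NoInducedC6) (h2 : (1 + 1 : Fin n) ≠ 0)
    (hch : ∀ k : Fin n, k + 1 + 1 ≠ k + 1 ∧ k ≠ k + 1 + 1 + 1) (hxy : ¬ G.Adj x y) {k l : Fin n}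
    (hk : G.Adj x (f k)) (hl : G.Adj y (f l)) : IndexFar k l := by
  have hvf : ∀ i, ¬ G.Adj v (f i) := fun i => h.not_adj_v (by simp)
  have hno := h.not_common_cycle hf h2
  have hno' := h.swap.not_common_cycle hf h2
  have hyx : ¬ G.Adj y x := fun e => hxy e.symm
  have hch' : ∀ k : Fin n, ¬ G.Adj (f k) (f (k + 1 + 1)) := fun k e => by
    rcases (hf.2 _ _).1 e with e | e
    exacts [(hch k).1 e, (hch k).2 e]
  refine ⟨?_, ?_, ?_, ?_, ?_⟩
  · rintro rfl; exact hno l ⟨hk, hl⟩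
  · rintro rfl; exact hf.not_adj_succ h5 hvf h.adj_x h.rotate.adj_x hxy hno hk hl
  · rintro rfl; exact hf.not_adj_succ h5 hvf h.rotate.adj_x h.adj_x hyx hno' hl hk
  · rintro rfl
    exact hf.not_adj_add_two h5 h6 hvf h.adj_x h.rotate.adj_x hxy hno (hch' k) hk hl
  · rintro rfl
    exact hf.not_adj_add_two h5 h6 hvf h.rotate.adj_x h.adj_x hyx hno' (hch' l) hl hk

/-- Adjacent neighbours of `v` do not have neighbours at distance two on a cycle. -/
theorem ne_add_two (h : G.CubicConfig S v (Finset.univ.image f) x y z) (hf : G.CycleOn f)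
    (h5 : G.NoInducedC5) (hadj : ∀ k : Fin n, k + 1 ≠ k ∧ k + 1 + 1 ≠ k)
    (hch : ∀ k : Fin n, k + 1 + 1 ≠ k + 1 ∧ k ≠ k + 1 + 1 + 1) (hxy : G.Adj x y) {k l : Fin n}
    (hk : G.Adj x (f k)) (hl : G.Adj y (f l)) : l ≠ k + 1 + 1 := by
  rintro rfl
  have hux : ∀ i, G.Adj x (f i) → i = k := fun i hi =>
    hf.1 (h.unique_nbr hxy (by simp) (by simp) hi hk)
  have huy : ∀ i, G.Adj y (f i) → i = k + 1 + 1 := fun i hi =>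
    hf.1 (h.swap.unique_nbr hxy.symm (by simp) (by simp) hi hl)
  refine h5 x (f k) (f (k + 1)) (f (k + 1 + 1)) y hk ((hf.2 _ _).2 (Or.inl rfl))
    ((hf.2 _ _).2 (Or.inl rfl)) hl.symm hxy.symm ?_ ?_ ?_ ?_ ?_
  · exact fun e => (hadj k).1 (hux _ e)
  · exact fun e => (hadj k).2 (hux _ e)
  · rw [hf.2]; exact fun e => e.elim (hch k).1 (hch k).2
  · exact fun e => (hadj k).2 (huy _ e.symm).symm
  · exact fun e => (hch k).1 (huy _ e.symm).symm

/-- Adjacent neighbours of `v` do not have neighbours at distance three on a cycle. -/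
theorem ne_add_three (h : G.CubicConfig S v (Finset.univ.image f) x y z) (hf : G.CycleOn f)
    (h6 : G.NoInducedC6)
    (hadj : ∀ k : Fin n, k + 1 ≠ k ∧ k + 1 + 1 ≠ k ∧ k + 1 + 1 + 1 ≠ k ∧ k + 1 + 1 + 1 + 1 ≠ k)
    (hxy : G.Adj x y) {k l : Fin n}
    (hk : G.Adj x (f k)) (hl : G.Adj y (f l)) : l ≠ k + 1 + 1 + 1 := by
  rintro rfl
  have hux : ∀ i, G.Adj x (f i) → i = k := fun i hi =>
    hf.1 (h.unique_nbr hxy (by simp) (by simp) hi hk)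
  have huy : ∀ i, G.Adj y (f i) → i = k + 1 + 1 + 1 := fun i hi =>
    hf.1 (h.swap.unique_nbr hxy.symm (by simp) (by simp) hi hl)
  refine h6 x (f k) (f (k + 1)) (f (k + 1 + 1)) (f (k + 1 + 1 + 1)) y hk ((hf.2 _ _).2 (Or.inl rfl))
    ((hf.2 _ _).2 (Or.inl rfl)) ((hf.2 _ _).2 (Or.inl rfl)) hl.symm hxy.symm
    ?_ ?_ ?_ ?_ ?_ ?_ ?_ ?_ ?_
  · exact fun e => (hadj k).1 (hux _ e)
  · exact fun e => (hadj k).2.1 (hux _ e)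
  · exact fun e => (hadj k).2.2.1 (hux _ e)
  · rw [hf.2]; exact fun e => e.elim (hadj (k + 1)).1 (hadj k).2.2.1.symm
  · rw [hf.2]; exact fun e => e.elim (hadj (k + 1)).2.1 (hadj k).2.2.2.symm
  · exact fun e => (hadj k).2.2.1 (huy _ e.symm).symm
  · rw [hf.2]; exact fun e => e.elim (hadj (k + 1 + 1)).1 (hadj (k + 1)).2.2.1.symm
  · exact fun e => (hadj (k + 1)).2.1 (huy _ e.symm).symm
  · exact fun e => (hadj (k + 1 + 1)).1 (huy _ e.symm).symm

/-- Adjacent neighbours `x, y` of `v` with consecutive neighbours on the cycle: it suffices to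
dominate `x`, `z` and the neighbour of `y`. -/
theorem false_of_adj_of_isolates {H : Finset V} (h : G.CubicConfig S v H x y z)
    (M : G.IsMinCounterexample S) (hxy : G.Adj x y) {D : Finset V} (hD : G.Isolates D H)
    (hDc : 4 * D.card ≤ H.card + 1) (hDx : ¬ G.Undominated D x) (hDz : ¬ G.Undominated D z)
    {c : V} (hc : c ∈ H) (hyc : G.Adj y c) (hDc' : ¬ G.Undominated D c) : False := by
  refine h.false_of_isolates M hD hDc hDx hDz fun _ w hw hyw hwv => ?_
  by_cases hwx : w = x
  · rwa [hwx]
  by_cases hwc : w = c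
  · rwa [hwc]
  exact (false_of_four_nbrs (h.hdeg y h.rotate.x_mem) h.hv h.x_mem (h.mem_S hc) hw
    h.rotate.adj_x.symm hxy.symm hyc hyw h.adj_x.ne (h.v_ne hc) (Ne.symm hwv) (h.x_ne hc)
    (Ne.symm hwx) (Ne.symm hwc)).elim

/-- The three attachments are pairwise at distance at least three. A 7-cycle has no room for that;
on an 11-cycle they form an isolating set dominating x, y and z. -/
theorem false_of_not_adj {H : Finset V} (h : G.CubicConfig S v H x y z)
    (M : G.IsMinCounterexample S) (h5 : G.NoInducedC5) (h6 : G.NoInducedC6)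
    (hxy : ¬ G.Adj x y) (hyz : ¬ G.Adj y z) (hzx : ¬ G.Adj z x) : False := by
  obtain ⟨p, hp, hxp⟩ := h.hx
  obtain ⟨q, hq, hyq⟩ := h.hy
  obtain ⟨r, hr, hzr⟩ := h.hz
  rcases h.memBad.2 with ⟨hcard, -⟩ | ⟨f, hf, rfl⟩ | ⟨f, hf, rfl⟩
  · exact h.card_ne_three_of_not_adj h5 h6 hxy hyz hzx hcard
  all_goals
    obtain ⟨g, hg, hfg, rfl⟩ := hf.exists_rotate hp
    rw [hfg] at hq hr h
    simp only [Finset.mem_image, Finset.mem_univ, true_and] at hq hr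
    obtain ⟨k, rfl⟩ := hq
    obtain ⟨l, rfl⟩ := hr
    have f1 := h.indexFar hg h5 h6 (by decide) (by decide) hxy hxp hyq
    have f2 := h.rotate.indexFar hg h5 h6 (by decide) (by decide) hyz hyq hzr
    have f3 := h.rotate.rotate.indexFar hg h5 h6 (by decide) (by decide) hzx hzr hxp
  · have key : ∀ k l : Fin 7, IndexFar 0 k → IndexFar k l → IndexFar l 0 → False := by decide
    exact key k l f1 f2 f3
  · have hc : ({g 0, g k, g l} : Finset V).card ≤ 3 := Finset.card_le_three
    exact h.false_of_isolates M (D := {g 0, g k, g l})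
      (hg.isolates_image {0, k, l} (by simp) (indexFar_cover k l f1 f2 f3)) (by rw [hg.card]; omega)
      (fun e => e.2 (g 0) (by simp) hxp.symm) (fun e => e.2 (g l) (by simp) hzr.symm)
      (fun e => absurd hyq.symm (e.2 (g k) (by simp)))

/-- The attachment of z is far from the other two, and those of x and y are not at distance 0, 2 or
3. If they are adjacent, choosing the attachment of x dominates that of y, which is all that y
requires. Otherwise, only possible on the 11-cycle, all three are pairwise far. -/
theorem false_of_adj {H : Finset V} (h : G.CubicConfig S v H x y z)
    (M : G.IsMinCounterexample S) (h5 : G.NoInducedC5) (h6 : G.NoInducedC6)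
    (hxy : G.Adj x y) : False := by
  have hxz := h.not_adj_xz hxy
  have hyz := h.swap.not_adj_xz hxy.symm
  obtain ⟨p, hp, hxp⟩ := h.hx
  obtain ⟨q, hq, hyq⟩ := h.hy
  obtain ⟨r, hr, hzr⟩ := h.hz
  rcases h.memBad.2 with ⟨hcard, -⟩ | ⟨f, hf, rfl⟩ | ⟨f, hf, rfl⟩
  · exact h.card_ne_three_of_adj h5 h6 hxy hcard
  all_goals
    obtain ⟨g, hg, hfg, rfl⟩ := hf.exists_rotate hp
    rw [hfg] at hq hr h
    simp only [Finset.mem_image, Finset.mem_univ, true_and] at hq hr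
    obtain ⟨k, rfl⟩ := hq
    obtain ⟨l, rfl⟩ := hr
    have f2 := h.rotate.indexFar hg h5 h6 (by decide) (by decide) hyz hyq hzr
    have f3 := h.rotate.rotate.indexFar hg h5 h6 (by decide) (by decide) (fun e => hxz e.symm)
      hzr hxp
    have k0 : k ≠ 0 := by rintro rfl; exact h.not_common_cycle hg (by decide) 0 ⟨hxp, hyq⟩
    have k2 := h.ne_add_two hg h5 (by decide) (by decide) hxy hxp hyq
    have k2' := h.swap.ne_add_two hg h5 (by decide) (by decide) hxy.symm hyq hxp
    have k3 := h.ne_add_three hg h6 (by decide) hxy hxp hyq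
    have k3' := h.swap.ne_add_three hg h6 (by decide) hxy.symm hyq hxp
  · have key : ∀ k l : Fin 7, IndexFar k l → IndexFar l 0 → k ≠ 0 → k ≠ 0 + 1 + 1 →
        0 ≠ k + 1 + 1 → k ≠ 0 + 1 + 1 + 1 → 0 ≠ k + 1 + 1 + 1 →
        (k = 0 ∨ k = 0 + 1 ∨ 0 = k + 1) ∧ ∀ i : Fin 7, ∃ m ∈ ({0, l} : Finset (Fin 7)),
          m + 1 = i ∨ m = i ∨ m = i + 1 ∨ m = i + 1 + 1 ∨ m = i + 1 + 1 + 1 := by decide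
    obtain ⟨hk, hiso⟩ := key k l f2 f3 k0 k2 k2' k3 k3'
    have hc : ({g 0, g l} : Finset V).card ≤ 2 := Finset.card_le_two
    exact h.false_of_adj_of_isolates M hxy (D := {g 0, g l})
      (hg.isolates_image {0, l} (by simp) hiso) (by rw [hg.card]; omega)
      (fun e => e.2 (g 0) (by simp) hxp.symm) (fun e => e.2 (g l) (by simp) hzr.symm)
      (c := g k) (by simp) hyq (hg.not_undominated (i := 0) (by simp) hk)
  · by_cases hk : k = 0 ∨ k = 0 + 1 ∨ 0 = k + 1
    · have key : ∀ l : Fin 11, l ≠ 0 → ∃ j : Fin 11, ∀ i : Fin 11,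
          ∃ m ∈ ({0, l, j} : Finset (Fin 11)),
          m + 1 = i ∨ m = i ∨ m = i + 1 ∨ m = i + 1 + 1 ∨ m = i + 1 + 1 + 1 := by decide
      obtain ⟨j, hiso⟩ := key l f3.1.symm
      have hc : ({g 0, g l, g j} : Finset V).card ≤ 3 := Finset.card_le_three
      exact h.false_of_adj_of_isolates M hxy (D := {g 0, g l, g j})
        (hg.isolates_image {0, l, j} (by simp) hiso) (by rw [hg.card]; omega)
        (fun e => e.2 (g 0) (by simp) hxp.symm) (fun e => e.2 (g l) (by simp) hzr.symm)
        (c := g k) (by simp) hyq (hg.not_undominated (i := 0) (by simp) hk)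
    · simp only [not_or] at hk
      have hc : ({g 0, g k, g l} : Finset V).card ≤ 3 := Finset.card_le_three
      exact h.false_of_isolates M (D := {g 0, g k, g l})
        (hg.isolates_image {0, k, l} (by simp) (indexFar_cover k l ⟨hk.1, hk.2.1, hk.2.2, k2, k2'⟩ f2 f3)) (by rw [hg.card]; omega)
        (fun e => e.2 (g 0) (by simp) hxp.symm) (fun e => e.2 (g l) (by simp) hzr.symm)
        (fun e => absurd hyq.symm (e.2 (g k) (by simp)))

theorem false {H : Finset V} (h : G.CubicConfig S v H x y z)
    (M : G.IsMinCounterexample S) (h5 : G.NoInducedC5) (h6 : G.NoInducedC6) : False := by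
  by_cases hxy : G.Adj x y
  · exact h.false_of_adj M h5 h6 hxy
  by_cases hyz : G.Adj y z
  · exact h.rotate.false_of_adj M h5 h6 hyz
  by_cases hzx : G.Adj z x
  · exact h.rotate.rotate.false_of_adj M h5 h6 hzx
  exact h.false_of_not_adj M h5 h6 hxy hyz hzx

end CubicConfig

theorem IsMinCounterexample.degree_le_two (M : G.IsMinCounterexample S) (h5 : G.NoInducedC5)
    (h6 : G.NoInducedC6) {v : V} (hv : v ∈ S) : (G.nbrs S v).card ≤ 2 := by
  by_contra! hd
  obtain ⟨hd3, H, hH, hmeet⟩ := M.degree_eq_three h5 h6 hv hd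
  obtain ⟨x, y, z, hxy, hxz, hyz, he⟩ := Finset.card_eq_three.1 hd3
  have hN : ∀ w, w ∈ S ∧ G.Adj v w ↔ w = x ∨ w = y ∨ w = z := fun w => by
    rw [← mem_nbrs, he]; simp
  refine CubicConfig.false (H := H) ⟨hv, hN, hxy, hxz, hyz, hH, hmeet x (by simp [he]),
    hmeet y (by simp [he]), hmeet z (by simp [he]), fun w hw => ?_⟩ M h5 h6
  -- The global degree bound of the configuration comes from applying the same lemma at every
  -- vertex.
  by_contra! hgt
  have := (M.degree_eq_three h5 h6 hw (by omega)).1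
  omega

end

/-! ### Maximum degree two: paths and cycles -/

section

/-- `f 0, …, f (n - 1)` are distinct vertices of `S`, consecutive ones being adjacent. -/
structure IsPathSeq {V : Type*} (G : SimpleGraph V) (S : Finset V) (n : ℕ) (f : ℕ → V) :
    Prop where
  mem : ∀ i, i < n → f i ∈ S
  inj : ∀ i j, i < n → j < n → f i = f j → i = j
  adj : ∀ i, i + 1 < n → G.Adj (f i) (f (i + 1))

variable {V : Type*} {G : SimpleGraph V} {S : Finset V} {n : ℕ} {f : ℕ → V}

theorem false_of_three_nbrs {w : V} (hw : (G.nbrs S w).card ≤ 2) {a b c : V} (ha : a ∈ S)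
    (hb : b ∈ S) (hc : c ∈ S) (hwa : G.Adj w a) (hwb : G.Adj w b) (hwc : G.Adj w c)
    (hab : a ≠ b) (hac : a ≠ c) (hbc : b ≠ c) : False := by
  have hsub : ({a, b, c} : Finset V) ⊆ G.nbrs S w := by
    simp only [Finset.insert_subset_iff, Finset.singleton_subset_iff, mem_nbrs]
    tauto
  have := Finset.card_le_card hsub
  rw [Finset.card_eq_three.2 ⟨a, b, c, hab, hac, hbc, rfl⟩] at this
  omega

theorem IsPathSeq.image_subset (hf : G.IsPathSeq S n f) : (Finset.range n).image f ⊆ S := by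
  intro x hx
  obtain ⟨i, hi, rfl⟩ := Finset.mem_image.1 hx
  exact hf.mem i (Finset.mem_range.1 hi)

theorem IsPathSeq.card_image (hf : G.IsPathSeq S n f) : ((Finset.range n).image f).card = n := by
  rw [Finset.card_image_of_injOn, Finset.card_range]
  intro i hi j hj h
  simp only [Finset.coe_range, Set.mem_Iio] at hi hj
  exact hf.inj i j hi hj h

/-- A connected set of maximum degree at most two has a spanning path. -/
theorem IsConn.exists_spanning_path (hS : G.IsConn S) (hdeg : ∀ v ∈ S, (G.nbrs S v).card ≤ 2) :
    ∃ n f, 0 < n ∧ G.IsPathSeq S n f ∧ S = (Finset.range n).image f := by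
  have hle : ∀ n, (∃ f, G.IsPathSeq S n f) → n ≤ S.card := by
    rintro n ⟨f, hf⟩
    rw [← hf.card_image]
    exact Finset.card_le_card hf.image_subset
  obtain ⟨s, hs⟩ := hS.1
  have h1 : ∃ f, G.IsPathSeq S 1 f :=
    ⟨fun _ => s, fun _ _ => hs, fun i j hi hj _ => by omega, fun i hi => by omega⟩
  set n := Nat.findGreatest (fun n => ∃ f, G.IsPathSeq S n f) S.card with hn
  have hn1 : 1 ≤ n := Nat.le_findGreatest (hle 1 h1) h1
  obtain ⟨f, hf⟩ : ∃ f, G.IsPathSeq S n f := 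
    Nat.findGreatest_spec (P := fun n => ∃ f, G.IsPathSeq S n f) (hle 1 h1) h1
  have hmax : ∀ g, ¬ G.IsPathSeq S (n + 1) g := fun g hg => by
    have := Nat.le_findGreatest (P := fun n => ∃ f, G.IsPathSeq S n f) (hle _ ⟨g, hg⟩) ⟨g, hg⟩
    omega
  refine ⟨n, f, hn1, hf, (hS.2 _ hf.image_subset ⟨f 0, ?_⟩ ?_).symm⟩
  · exact Finset.mem_image_of_mem f (Finset.mem_range.2 hn1)
  -- A longest path is closed under adjacency: an edge leaving at an end would extend it, and one
  -- leaving at an inner vertex would be a third edge there.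
  · intro a ha b hb hab
    obtain ⟨i, hi, rfl⟩ := Finset.mem_image.1 ha
    rw [Finset.mem_range] at hi
    by_contra hbA
    have hbne : ∀ j, j < n → f j ≠ b := fun j hj h =>
      hbA (Finset.mem_image.2 ⟨j, Finset.mem_range.2 hj, h⟩)
    by_cases hin : i + 1 = n
    · refine hmax (fun j => if j < n then f j else b) ⟨?_, ?_, ?_⟩
      · intro j hj
        split_ifs with h
        exacts [hf.mem j h, hb]
      · intro j k hj hk h
        split_ifs at h with h1 h2 h2
        · exact hf.inj j k h1 h2 h
        · exact absurd h (hbne j h1)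
        · exact absurd h.symm (hbne k h2)
        · omega
      · intro j hj
        rw [if_pos (by omega)]
        split_ifs with h
        · exact hf.adj j h
        · obtain rfl : j = i := by omega
          exact hab
    · rcases Nat.eq_zero_or_pos i with rfl | hi0
      · refine hmax (fun j => if j = 0 then b else f (j - 1)) ⟨?_, ?_, ?_⟩
        · intro j hj
          split_ifs with h
          exacts [hb, hf.mem _ (by omega)]
        · intro j k hj hk h
          split_ifs at h with h1 h2 h2
          · omega
          · exact absurd h.symm (hbne _ (by omega))
          · exact absurd h (hbne _ (by omega))
          · have := hf.inj _ _ (by omega) (by omega) h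
            omega
        · intro j hj
          rw [if_neg (Nat.succ_ne_zero j), Nat.add_sub_cancel]
          split_ifs with h
          · rw [h]; exact hab.symm
          · have := hf.adj (j - 1) (by omega)
            rwa [Nat.sub_add_cancel (by omega)] at this
      · have h1 := hf.adj (i - 1) (by omega)
        rw [Nat.sub_add_cancel hi0] at h1
        refine false_of_three_nbrs (hdeg _ (hf.mem i hi)) (hf.mem (i - 1) (by omega))
          (hf.mem (i + 1) (by omega)) hb h1.symm (hf.adj i (by omega)) hab ?_
          (hbne _ (by omega)) (hbne _ (by omega))
        intro h
        have := hf.inj _ _ (by omega) (by omega) h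
        omega

/-- In maximum degree two, a path has no chords except possibly between its ends. -/
theorem IsPathSeq.eq_of_adj (hf : G.IsPathSeq S n f) (hdeg : ∀ v ∈ S, (G.nbrs S v).card ≤ 2)
    {i j : ℕ} (hij : i < j) (hj : j < n) (hadj : G.Adj (f i) (f j)) :
    j = i + 1 ∨ i = 0 ∧ j + 1 = n := by
  by_contra! hcon
  by_cases hi : i = 0
  · have h1 := hf.adj (j - 1) (by omega)
    rw [Nat.sub_add_cancel (by omega)] at h1
    refine false_of_three_nbrs (hdeg _ (hf.mem j hj)) (hf.mem (j - 1) (by omega))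
      (hf.mem (j + 1) (by omega)) (hf.mem i (by omega)) h1.symm (hf.adj j (by omega))
      hadj.symm ?_ ?_ ?_ <;>
    · intro h
      have := hf.inj _ _ (by omega) (by omega) h
      omega
  · have h1 := hf.adj (i - 1) (by omega)
    rw [Nat.sub_add_cancel (by omega)] at h1
    refine false_of_three_nbrs (hdeg _ (hf.mem i (by omega))) (hf.mem (i - 1) (by omega))
      (hf.mem (i + 1) (by omega)) (hf.mem j (by omega)) h1.symm (hf.adj i (by omega)) hadj
      ?_ ?_ ?_ <;>
    · intro h
      have := hf.inj _ _ (by omega) (by omega) h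
      omega

/-- On an induced path it suffices that no three consecutive vertices are undominated. -/
theorem isolates_of_path (hS : S = (Finset.range n).image f)
    (hchord : ∀ i j, i < j → j < n → G.Adj (f i) (f j) → j = i + 1) {D : Finset V}
    (h : ∀ i, i + 2 < n → ¬ (G.Undominated D (f i) ∧ G.Undominated D (f (i + 1)) ∧
      G.Undominated D (f (i + 2)))) : G.Isolates D S := by
  have hadj : ∀ i j, i < n → j < n → G.Adj (f i) (f j) → j = i + 1 ∨ i = j + 1 := by
    intro i j hi hj hij
    rcases lt_trichotomy i j with hlt | rfl | hlt
    exacts [Or.inl (hchord i j hlt hj hij), absurd rfl hij.ne,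
      Or.inr (hchord j i hlt hi hij.symm)]
  intro u hu a ha b hb h1 h2 h3 hua hub
  simp only [hS, Finset.mem_image, Finset.mem_range] at hu ha hb
  obtain ⟨i, hi, rfl⟩ := hu
  obtain ⟨j, hj, rfl⟩ := ha
  obtain ⟨k, hk, rfl⟩ := hb
  have hik := hadj i k hi hk hub
  rcases hadj i j hi hj hua with rfl | rfl <;> rcases hik with h' | h'
  · rw [h']
  · subst h'; exact absurd ⟨h3, h1, h2⟩ (h k hj)
  · subst h'; exact absurd ⟨h2, h1, h3⟩ (h j hk)
  · rw [Nat.succ.inj h']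

theorem IsPathSeq.good_of_no_chord (hf : G.IsPathSeq S n f) (hS : S = (Finset.range n).image f)
    (hchord : ∀ i j, i < j → j < n → G.Adj (f i) (f j) → j = i + 1) (h4 : 4 ≤ n) : G.Good S := by
  -- Choosing the indices 3, 7, 11, … leaves 0 and 1 in front, single vertices between, and at most
  -- two at the end.
  refine ⟨(Finset.range (n / 4)).image fun j => f (4 * j + 3), isolates_of_path hS hchord ?_, ?_⟩
  · intro i hi hund
    obtain ⟨j, hj, h1, h2⟩ : ∃ j, j < n / 4 ∧ 4 * j ≤ i ∧ i ≤ 4 * j + 4 := by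
      by_cases h : i / 4 < n / 4
      · exact ⟨i / 4, h, by omega, by omega⟩
      · exact ⟨n / 4 - 1, by omega, by omega, by omega⟩
    have hD : f (4 * j + 3) ∈ (Finset.range (n / 4)).image fun j => f (4 * j + 3) :=
      Finset.mem_image.2 ⟨j, Finset.mem_range.2 hj, rfl⟩
    have key : ∀ m, m < n → (m = 4 * j + 3 ∨ m = 4 * j + 4 ∨ m = 4 * j + 2) →
        ¬ G.Undominated ((Finset.range (n / 4)).image fun j => f (4 * j + 3)) (f m) := by
      rintro m hm (rfl | rfl | rfl) hu
      · exact hu.1 hD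
      · exact hu.2 _ hD (hf.adj _ hm)
      · exact hu.2 _ hD (hf.adj _ (by omega)).symm
    obtain rfl | rfl | rfl | rfl | rfl :
        i = 4 * j ∨ i = 4 * j + 1 ∨ i = 4 * j + 2 ∨ i = 4 * j + 3 ∨ i = 4 * j + 4 := by omega
    · exact key _ (by omega) (by omega) hund.2.2
    · exact key _ (by omega) (by omega) hund.2.1
    · exact key _ (by omega) (by omega) hund.1
    · exact key _ (by omega) (by omega) hund.1
    · exact key _ (by omega) (by omega) hund.1
  · have h1 : ((Finset.range (n / 4)).image fun j => f (4 * j + 3)).card ≤ n / 4 :=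
      Finset.card_image_le.trans (by simp)
    rw [hS, hf.card_image]
    omega

theorem ofNat_succ [NeZero n] (k : ℕ) : Fin.ofNat n (k + 1) = Fin.ofNat n k + 1 := by
  ext
  simp [Fin.val_add]

/-- Cycles whose length is a sum of fours and fives are good. -/
theorem CycleOn.good [NeZero n] {g : Fin n → V} (hg : G.CycleOn g) {q r : ℕ}
    (hn : n = 4 * q + r) (hq : 0 < q) (hrq : r ≤ q) : G.Good (Finset.univ.image g) := by
  -- The first r gaps have length five and the others four; a gap of five leaves two consecutive
  -- vertices undominated.
  set D := (Finset.range q).image fun j => g (Fin.ofNat n (4 * j + min j r)) with hD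
  refine ⟨D, hg.isolates fun i hi => ?_, ?_⟩
  · obtain ⟨m, hm, h1, h2⟩ : ∃ m, g (Fin.ofNat n m) ∈ D ∧ i.val ≤ m + 1 ∧ m ≤ i.val + 3 := by
      have hin := i.isLt
      have hmem : ∀ j, j < q → g (Fin.ofNat n (4 * j + min j r)) ∈ D := fun j hj =>
        Finset.mem_image.2 ⟨j, Finset.mem_range.2 hj, rfl⟩
      by_cases h : n ≤ i.val + 3
      -- Windows reaching round the end use the chosen vertex 0, read as index n; for the others, m
      -- is the largest chosen index up to i + 3.
      · refine ⟨n, ?_, by omega, h⟩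
        have := hmem 0 hq
        have e : Fin.ofNat n n = Fin.ofNat n (4 * 0 + min 0 r) := by ext; simp
        rwa [← e] at this
      · by_cases h5 : i.val + 3 < 5 * r
        · exact ⟨_, hmem ((i.val + 3) / 5) (by omega), by omega, by omega⟩
        · exact ⟨_, hmem ((i.val + 3 - r) / 4) (by omega), by omega, by omega⟩
    have hi0 : Fin.ofNat n i.val = i := by ext; simp
    have hi1 : Fin.ofNat n (i.val + 1) = i + 1 := by rw [ofNat_succ, hi0]
    have hi2 : Fin.ofNat n (i.val + 2) = i + 1 + 1 := by rw [ofNat_succ, hi1]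
    have hi3 : Fin.ofNat n (i.val + 3) = i + 1 + 1 + 1 := by rw [ofNat_succ, hi2]
    rcases (by omega : i.val = m + 1 ∨ m = i.val ∨ m = i.val + 1 ∨ m = i.val + 2 ∨
      m = i.val + 3) with h | rfl | rfl | rfl | rfl
    · refine hg.not_undominated hm (Or.inr (Or.inl ?_)) hi.1
      rw [← ofNat_succ, ← h, hi0]
    · exact hg.not_undominated hm (Or.inl hi0.symm) hi.1
    · exact hg.not_undominated hm (Or.inl hi1.symm) hi.2.1
    · exact hg.not_undominated hm (Or.inl hi2.symm) hi.2.2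
    · exact hg.not_undominated hm (Or.inr (Or.inr hi3)) hi.2.2
  · have h1 : D.card ≤ q := Finset.card_image_le.trans (by simp)
    rw [hg.card]
    omega

/-- A spanning path in maximum degree two whose ends are adjacent closes up to an induced cycle. -/
theorem IsPathSeq.cycleOn [NeZero n] (hf : G.IsPathSeq S n f)
    (hdeg : ∀ v ∈ S, (G.nbrs S v).card ≤ 2) (h3 : 3 ≤ n) (hadj : G.Adj (f 0) (f (n - 1))) :
    G.CycleOn fun i : Fin n => f i.val := by
  have hsucc : ∀ i j : Fin n, j = i + 1 ↔ i.val + 1 = j.val ∨ i.val + 1 = n ∧ j.val = 0 := by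
    intro i j
    rw [Fin.ext_iff, Fin.val_add, Fin.val_one', Nat.add_mod_mod]
    have hi := i.isLt
    rcases (by omega : i.val + 1 < n ∨ i.val + 1 = n) with h | h
    · rw [Nat.mod_eq_of_lt h]; omega
    · rw [h, Nat.mod_self]; omega
  have hlt : ∀ i j : Fin n, i.val < j.val → G.Adj (f i.val) (f j.val) → j = i + 1 ∨ i = j + 1 := by
    intro i j hij h
    rw [hsucc, hsucc]
    rcases hf.eq_of_adj hdeg hij j.isLt h with h | h <;> omega
  have hback : ∀ i j : Fin n, j = i + 1 → G.Adj (f i.val) (f j.val) := by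
    intro i j h
    rcases (hsucc i j).1 h with h | ⟨h, h0⟩
    · rw [← h]; exact hf.adj _ (by have := j.isLt; omega)
    · rw [h0, show i.val = n - 1 by omega]; exact hadj.symm
  refine ⟨fun i j h => Fin.ext (hf.inj _ _ i.isLt j.isLt h), fun i j => ⟨fun h => ?_, ?_⟩⟩
  · rcases lt_trichotomy i.val j.val with hij | hij | hij
    · exact hlt i j hij h
    · exact absurd (congrArg f hij) h.ne
    · exact (hlt j i hij h.symm).symm
  · rintro (h | h)
    exacts [hback i j h, (hback j i h).symm]

theorem image_val_eq_image_range : (Finset.univ.image fun i : Fin n => f i.val) =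
    (Finset.range n).image f := by
  ext x
  simp only [Finset.mem_image, Finset.mem_univ, true_and, Finset.mem_range]
  exact ⟨fun ⟨i, hi⟩ => ⟨i.val, i.isLt, hi⟩, fun ⟨i, hi, h⟩ => ⟨⟨i, hi⟩, h⟩⟩

/-- Connected sets of maximum degree at most two are good or bad. -/
theorem IsConn.good_or_bad_of_degree_le_two (hS : G.IsConn S) (h6 : G.NoInducedC6)
    (hdeg : ∀ v ∈ S, (G.nbrs S v).card ≤ 2) : G.Good S ∨ G.Bad S := by
  obtain ⟨n, f, hn0, hf, hSf⟩ := hS.exists_spanning_path hdeg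
  have hcard : S.card = n := by rw [hSf, hf.card_image]
  rcases (by omega : n ≤ 2 ∨ n = 3 ∨ 4 ≤ n) with h | h | h4
  · exact Or.inl ⟨∅, isolates_of_card_le_two (hcard.trans_le h) fun u hu _ => hu, by simp⟩
  · exact Or.inr (Or.inl ⟨by omega, hS⟩)
  by_cases hadj : G.Adj (f 0) (f (n - 1))
  · have : NeZero n := ⟨by omega⟩
    have hg := hf.cycleOn hdeg (by omega) hadj
    rw [← image_val_eq_image_range] at hSf
    by_cases hr : n % 4 ≤ n / 4
    · rw [hSf]
      exact Or.inl (hg.good (q := n / 4) (r := n % 4) (by omega) (by omega) hr)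
    -- These are the only n ≥ 4 that are not sums of fours and fives.
    · obtain rfl | rfl | rfl : n = 6 ∨ n = 7 ∨ n = 11 := by omega
      · exfalso
        refine h6 (f 0) (f 1) (f 2) (f 3) (f 4) (f 5) (hf.adj 0 (by omega)) (hf.adj 1 (by omega))
          (hf.adj 2 (by omega)) (hf.adj 3 (by omega)) (hf.adj 4 (by omega)) hadj.symm
          ?_ ?_ ?_ ?_ ?_ ?_ ?_ ?_ ?_ <;>
        · intro h
          have := hf.eq_of_adj hdeg (by omega) (by omega) h
          omega
      · exact Or.inr (Or.inr (Or.inl ⟨_, hg, hSf⟩))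
      · exact Or.inr (Or.inr (Or.inr ⟨_, hg, hSf⟩))
  · refine Or.inl (hf.good_of_no_chord hSf (fun i j hij hj h => ?_) h4)
    rcases hf.eq_of_adj hdeg hij hj h with h' | ⟨rfl, h'⟩
    · exact h'
    · obtain rfl : j = n - 1 := by omega
      exact absurd h hadj

/-- Every connected set is good or bad if there are no induced 5- and 6-cycles. -/
theorem IsConn.good_or_bad (h5 : G.NoInducedC5) (h6 : G.NoInducedC6) (hS : G.IsConn S) :
    G.Good S ∨ G.Bad S := by
  induction S using Finset.strongInduction with
  | H S ih =>
    by_contra! hcon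
    have M : G.IsMinCounterexample S :=
      ⟨hS, fun T hT hne hTc => ih T (Finset.ssubset_iff_subset_ne.2 ⟨hT, hne⟩) hTc, hcon.1⟩
    rcases hS.good_or_bad_of_degree_le_two h6 (fun v hv => M.degree_le_two h5 h6 hv) with h | h
    exacts [hcon.1 h, hcon.2 h]

end

/-! ### From vertex sets back to graphs and isomorphism types -/

section Transfer

variable {V : Type*} {G : SimpleGraph V}

/-- Distinctness need not be assumed: identifying two nonconsecutive vertices would contradict the
adjacency pattern. -/
theorem noInducedC5_of_not_isIndContained (h : ¬ (cycleGraph 5).IsIndContained G) :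
    G.NoInducedC5 := by
  intro a b c d e hab hbc hcd hde hea hac had hbd hbe hce
  have nac : a ≠ c := by rintro rfl; exact had hcd
  have nad : a ≠ d := by rintro rfl; exact hac hcd.symm
  have nbd : b ≠ d := by rintro rfl; exact hbe hde
  have nbe : b ≠ e := by rintro rfl; exact hbd hde.symm
  have nce : c ≠ e := by rintro rfl; exact hac hea.symm
  have hinj : Function.Injective ![a, b, c, d, e] := by
    intro i j hij
    fin_cases i <;> fin_cases j <;>
      simp_all [hab.ne, hbc.ne, hcd.ne, hde.ne, hea.ne, hab.ne', hbc.ne', hcd.ne', hde.ne', hea.ne']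
  refine h ⟨⟨⟨_, hinj⟩, ?_⟩⟩
  intro i j
  have hsymm := hea.symm
  fin_cases i <;> fin_cases j <;> simp [cycleGraph_adj, G.adj_comm, *] <;> decide

theorem noInducedC6_of_not_isIndContained (h : ¬ (cycleGraph 6).IsIndContained G) :
    G.NoInducedC6 := by
  intro a b c d e f hab hbc hcd hde hef hfa hac had hae hbd hbe hbf hce hcf hdf
  have nac : a ≠ c := by rintro rfl; exact had hcd
  have nad : a ≠ d := by rintro rfl; exact hac hcd.symm
  have nae : a ≠ e := by rintro rfl; exact had hde.symm
  have nbd : b ≠ d := by rintro rfl; exact hbe hde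
  have nbe : b ≠ e := by rintro rfl; exact hbd hde.symm
  have nbf : b ≠ f := by rintro rfl; exact hbe hef.symm
  have nce : c ≠ e := by rintro rfl; exact hcf hef
  have ncf : c ≠ f := by rintro rfl; exact hce hef.symm
  have ndf : d ≠ f := by rintro rfl; exact had hfa.symm
  have hinj : Function.Injective ![a, b, c, d, e, f] := by
    intro i j hij
    fin_cases i <;> fin_cases j <;>
      simp_all [hab.ne, hbc.ne, hcd.ne, hde.ne, hef.ne, hfa.ne, hab.ne', hbc.ne', hcd.ne', hde.ne',
        hef.ne', hfa.ne']
  refine h ⟨⟨⟨_, hinj⟩, ?_⟩⟩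
  intro i j
  have hsymm := hfa.symm
  fin_cases i <;> fin_cases j <;> simp [cycleGraph_adj, G.adj_comm, *] <;> decide

variable [Fintype V]

theorem Connected.isConn_univ (h : G.Connected) : G.IsConn Finset.univ := by
  have := h.nonempty
  refine ⟨Finset.univ_nonempty, fun A _ ⟨a, ha⟩ hA => Finset.eq_univ_iff_forall.2 fun b => ?_⟩
  obtain ⟨w⟩ := h.preconnected a b
  induction w with
  | nil => exact ha
  | cons hadj _ ih => exact ih (hA _ ha _ (Finset.mem_univ _) hadj)

theorem Isolates.isIsolatingSet {D : Finset V} (h : G.Isolates D Finset.univ) :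
    G.IsIsolatingSet 1 D := by
  have hund : ∀ u, u ∈ (G.closedNeighborhood (D : Set V))ᶜ → G.Undominated D u := by
    intro u hu
    exact ⟨fun h => hu (Or.inl h), fun d hd h => hu (Or.inr ⟨d, hd, h⟩)⟩
  refine maxDegree_le_of_forall_degree_le _ _ fun u => ?_
  rw [← card_neighborFinset_eq_degree]
  refine Finset.card_le_one.2 fun a ha b hb => Subtype.ext ?_
  rw [mem_neighborFinset, comap_adj] at ha hb
  exact h u (Finset.mem_univ _) a (Finset.mem_univ _) b (Finset.mem_univ _) (hund _ u.2)
    (hund _ a.2) (hund _ b.2) ha hb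

/-- An induced cycle through all vertices is an isomorphism. -/
theorem CycleOn.nonempty_iso {n : ℕ} {f : Fin (n + 2) → V} (hf : G.CycleOn f)
    (h : Finset.univ = Finset.univ.image f) : Nonempty (G ≃g cycleGraph (n + 2)) := by
  have hsurj : Function.Surjective f := fun x => by
    have : x ∈ Finset.univ.image f := h ▸ Finset.mem_univ x
    simpa using this
  refine ⟨(RelIso.symm ⟨Equiv.ofBijective f ⟨hf.1, hsurj⟩, fun {i j} => ?_⟩)⟩
  change G.Adj (f i) (f j) ↔ _
  rw [cycleGraph_adj, hf.2, sub_eq_iff_eq_add', sub_eq_iff_eq_add']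
  exact or_comm

theorem Bad.isExceptionalGraph (h : G.Bad Finset.univ) : G.IsExceptionalGraph := by
  rcases h with ⟨hcard, hconn⟩ | ⟨f, hf, h⟩ | ⟨f, hf, h⟩
  · by_cases hall : ∀ p q, p ≠ q → G.Adj p q
    · refine Or.inr (Or.inl ?_)
      rw [cycleGraph_three_eq_top]
      refine ⟨⟨Fintype.equivFinOfCardEq hcard, fun {a b} => ?_⟩⟩
      rw [top_adj, (Fintype.equivFinOfCardEq hcard).injective.ne_iff]
      exact ⟨hall a b, fun e => e.ne⟩
    · push Not at hall
      obtain ⟨p, q, hpq, hadj⟩ := hall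
      obtain ⟨r, -, hpr, hrq⟩ :=
        hconn.exists_common hcard (Finset.mem_univ p) (Finset.mem_univ q) hpq hadj
      have hinj : Function.Injective ![p, r, q] := by
        intro i j hij
        fin_cases i <;> fin_cases j <;>
          simp_all [hpr.ne, hrq.ne, hpr.ne', hrq.ne', hpq.symm]
      have hbij : Function.Bijective ![p, r, q] :=
        (Fintype.bijective_iff_injective_and_card _).2 ⟨hinj, by
          rw [Fintype.card_fin]; exact hcard.symm⟩
      refine Or.inl ⟨(RelIso.symm ⟨Equiv.ofBijective _ hbij, fun {i j} => ?_⟩)⟩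
      rw [pathGraph_adj]
      fin_cases i <;> fin_cases j <;> simp [hpr, hrq, hpr.symm, hrq.symm, hadj, G.adj_comm q p]
  · exact Or.inr (Or.inr (Or.inl (hf.nonempty_iso h)))
  · exact Or.inr (Or.inr (Or.inr (hf.nonempty_iso h)))

theorem exists_isIsolatingSet (hG : G.Connected) (h5 : ¬ (cycleGraph 5).IsIndContained G)
    (h6 : ¬ (cycleGraph 6).IsIndContained G) (hex : ¬ G.IsExceptionalGraph) :
    ∃ D : Finset V, G.IsIsolatingSet 1 D ∧ 4 * D.card ≤ Fintype.card V := by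
  rcases hG.isConn_univ.good_or_bad (noInducedC5_of_not_isIndContained h5)
    (noInducedC6_of_not_isIndContained h6) with ⟨D, hD, hc⟩ | h
  · exact ⟨D, hD.isIsolatingSet, hc⟩
  · exact absurd h.isExceptionalGraph hex

theorem four_mul_isolationNumber_le (hG : G.Connected) (h5 : ¬ (cycleGraph 5).IsIndContained G)
    (h6 : ¬ (cycleGraph 6).IsIndContained G) (hex : ¬ G.IsExceptionalGraph) :
    4 * G.isolationNumber 1 ≤ Fintype.card V := by
  obtain ⟨D, hD, hc⟩ := exists_isIsolatingSet hG h5 h6 hex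
  have : G.isolationNumber 1 ≤ D.card := Nat.sInf_le ⟨D, hD, rfl⟩
  omega

end Transfer

/-! ### Sharpness: copies of K₄ joined through a clique of hubs -/

section Sharpness

/-- The graph consisting of `t` disjoint complete graphs on four vertices, with one vertex chosen in
each and the chosen vertices pairwise adjacent. -/
def blockGraph (t : ℕ) : SimpleGraph (Fin (4 * t)) where
  Adj u v := u ≠ v ∧ (u.val / 4 = v.val / 4 ∨ u.val % 4 = 0 ∧ v.val % 4 = 0)
  symm := ⟨fun _ _ h => ⟨h.1.symm, h.2.imp Eq.symm And.symm⟩⟩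
  loopless := ⟨fun _ h => h.1 rfl⟩

variable {t : ℕ}

theorem blockGraph_adj {u v : Fin (4 * t)} : (blockGraph t).Adj u v ↔
    u ≠ v ∧ (u.val / 4 = v.val / 4 ∨ u.val % 4 = 0 ∧ v.val % 4 = 0) := Iff.rfl

theorem blockGraph_connected (ht : 1 ≤ t) : (blockGraph t).Connected := by
  have : Nonempty (Fin (4 * t)) := ⟨⟨0, by omega⟩⟩
  have key : ∀ u v : Fin (4 * t), u.val / 4 = v.val / 4 ∨ u.val % 4 = 0 ∧ v.val % 4 = 0 →
      (blockGraph t).Reachable u v := by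
    intro u v h
    by_cases huv : u = v
    · rw [huv]
    · exact Adj.reachable ⟨huv, h⟩
  refine ⟨fun u v => ?_⟩
  have hu := u.isLt
  have hv := v.isLt
  refine ((key u ⟨4 * (u.val / 4), by omega⟩ (Or.inl ?_)).trans
    (key _ ⟨4 * (v.val / 4), by omega⟩ (Or.inr ?_))).trans (key _ v (Or.inl ?_))
  all_goals
    dsimp only
    omega

/-- All neighbours of a non-hub lie in its own block, which is a clique; so the middle of an induced
path on three vertices is a hub. -/
theorem blockGraph_mod_eq_zero {a b c : Fin (4 * t)} (hab : (blockGraph t).Adj a b)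
    (hbc : (blockGraph t).Adj b c) (hne : a ≠ c) (hac : ¬ (blockGraph t).Adj a c) :
    b.val % 4 = 0 := by
  rw [blockGraph_adj] at hab hbc hac
  by_contra hb
  exact hac ⟨hne, Or.inl (by omega)⟩

/-- The vertices 1 and 3 of such a cycle would be middles of induced paths, hence hubs, hence
adjacent, although they are at distance two. -/
theorem blockGraph_not_isIndContained (n : ℕ) :
    ¬ (cycleGraph (n + 5)).IsIndContained (blockGraph t) := by
  rintro ⟨e⟩
  have hadj : ∀ i j : Fin (n + 5), i < j →
      ((blockGraph t).Adj (e i) (e j) ↔ i.val + 1 = j.val ∨ j.val = i.val + (n + 4)) := by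
    intro i j hij
    rw [e.map_adj_iff, cycleGraph_adj', Fin.sub_val_of_le hij.le, Fin.coe_sub_iff_lt.2 hij]
    rw [Fin.lt_def] at hij
    omega
  let w (k : ℕ) (hk : k < 5) : Fin (n + 5) := ⟨k, by omega⟩
  have hw : ∀ k l (hk : k < 5) (hl : l < 5), k < l →
      ((blockGraph t).Adj (e (w k hk)) (e (w l hl)) ↔ k + 1 = l ∨ l = k + (n + 4)) :=
    fun k l hk hl hkl => hadj (w k hk) (w l hl) hkl
  have hne : ∀ k l (hk : k < 5) (hl : l < 5), k ≠ l → e (w k hk) ≠ e (w l hl) :=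
    fun k l hk hl hkl h => hkl (congrArg Fin.val (e.injective h))
  have h1 := blockGraph_mod_eq_zero ((hw 0 1 (by omega) (by omega) (by omega)).2 (by omega))
    ((hw 1 2 (by omega) (by omega) (by omega)).2 (by omega)) (hne 0 2 (by omega) (by omega) (by omega))
    (by rw [hw 0 2 (by omega) (by omega) (by omega)]; omega)
  have h3 := blockGraph_mod_eq_zero ((hw 2 3 (by omega) (by omega) (by omega)).2 (by omega))
    ((hw 3 4 (by omega) (by omega) (by omega)).2 (by omega)) (hne 2 4 (by omega) (by omega) (by omega))
    (by rw [hw 2 4 (by omega) (by omega) (by omega)]; omega)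
  have h13 := (hw 1 3 (by omega) (by omega) (by omega)).1 ⟨hne 1 3 (by omega) (by omega) (by omega), Or.inr ⟨h1, h3⟩⟩
  omega

theorem not_isExceptionalGraph_of_four_mul (G : SimpleGraph (Fin (4 * t))) :
    ¬ G.IsExceptionalGraph := by
  have hcard : ∀ {n : ℕ} {H : SimpleGraph (Fin n)}, Nonempty (G ≃g H) → 4 * t = n := by
    rintro n H ⟨e⟩
    simpa using Fintype.card_congr e.toEquiv
  rintro (h | h | h | h)
  all_goals
    have := hcard h
    omega

/-- If D misses a block, the three non-hubs there form an undominated triangle, so D meets each of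
the t blocks. -/
theorem blockGraph_le_card {D : Finset (Fin (4 * t))} (hD : (blockGraph t).IsIsolatingSet 1 D) :
    t ≤ D.card := by
  have hsub : Finset.range t ⊆ D.image fun d => d.val / 4 := by
    intro i hi
    rw [Finset.mem_range] at hi
    by_contra hcon
    simp only [Finset.mem_image, not_exists, not_and] at hcon
    have hund : ∀ u : Fin (4 * t), u.val / 4 = i → u.val % 4 ≠ 0 →
        u ∈ ((blockGraph t).closedNeighborhood (D : Set (Fin (4 * t))))ᶜ := by
      rintro u hu hu0 (h | ⟨d, hd, -, h | h⟩)
      · exact hcon u h hu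
      · exact hcon d hd (h.trans hu)
      · exact hu0 h.2
    let w (k : ℕ) (hk : k < 3) :
        (((blockGraph t).closedNeighborhood (D : Set (Fin (4 * t))))ᶜ : Set _) :=
      ⟨⟨4 * i + k + 1, by omega⟩, hund _ (by dsimp only; omega) (by dsimp only; omega)⟩
    have hdeg := (degree_le_maxDegree _ (w 0 (by omega))).trans hD
    rw [← card_neighborFinset_eq_degree, Finset.card_le_one] at hdeg
    have hw : ∀ k (hk : k < 3), k ≠ 0 →
        ((blockGraph t).induce ((blockGraph t).closedNeighborhood (D : Set (Fin (4 * t))))ᶜ).Adj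
          (w 0 (by omega)) (w k hk) := by
      intro k hk hk0
      rw [comap_adj]
      refine blockGraph_adj.2 ⟨fun h => ?_, Or.inl ?_⟩
      · have := congrArg Fin.val h
        simp [w] at this
        omega
      · simp only [w, Function.Embedding.subtype_apply]
        omega
    have := hdeg (w 1 (by omega)) (by rw [mem_neighborFinset]; exact hw 1 (by omega) (by omega))
      (w 2 (by omega)) (by rw [mem_neighborFinset]; exact hw 2 (by omega) (by omega))
    simp [w] at this
  have := (Finset.card_le_card hsub).trans Finset.card_image_le
  rwa [Finset.card_range] at this

theorem blockGraph_isolationNumber (ht : 1 ≤ t) : (blockGraph t).isolationNumber 1 = t := by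
  have h5 := blockGraph_not_isIndContained (t := t) 0
  have h6 := blockGraph_not_isIndContained (t := t) 1
  have hle := four_mul_isolationNumber_le (blockGraph_connected ht) h5 h6
    (not_isExceptionalGraph_of_four_mul _)
  -- A witness is needed because `sInf` of the empty set is 0; the upper bound is the theorem
  -- itself.
  obtain ⟨D, hD, -⟩ := exists_isIsolatingSet (blockGraph_connected ht) h5 h6
    (not_isExceptionalGraph_of_four_mul _)
  obtain ⟨D', hD', hc⟩ := Nat.sInf_mem (s := {m : ℕ | ∃ D : Finset (Fin (4 * t)),
    (blockGraph t).IsIsolatingSet 1 D ∧ D.card = m}) ⟨_, D, hD, rfl⟩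
  have hge := blockGraph_le_card hD'
  rw [Fintype.card_fin] at hle
  rw [hc] at hge
  exact le_antisymm (by omega) hge

end Sharpness

end SimpleGraph

theorem theorem1p7 :
    (∀ {V : Type*} [Fintype V] (G : SimpleGraph V), G.Connected →
      ¬ (SimpleGraph.cycleGraph 5).IsIndContained G →
      ¬ (SimpleGraph.cycleGraph 6).IsIndContained G →
      ¬ G.IsExceptionalGraph →
      (G.isolationNumber 1 : ℝ) ≤ (Fintype.card V : ℝ) / 4) ∧
    (∀ t : ℕ, 1 ≤ t → ∃ G : SimpleGraph (Fin (4 * t)), G.Connected ∧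
      ¬ (SimpleGraph.cycleGraph 5).IsIndContained G ∧
      ¬ (SimpleGraph.cycleGraph 6).IsIndContained G ∧
      ¬ G.IsExceptionalGraph ∧
      (G.isolationNumber 1 : ℝ) = (Fintype.card (Fin (4 * t)) : ℝ) / 4) := by
  refine ⟨fun {V} _ G hG h5 h6 hex => ?_, fun t ht => ⟨SimpleGraph.blockGraph t,
    SimpleGraph.blockGraph_connected ht, SimpleGraph.blockGraph_not_isIndContained 0,
    SimpleGraph.blockGraph_not_isIndContained 1,
    SimpleGraph.not_isExceptionalGraph_of_four_mul _, ?_⟩⟩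
  · have h := SimpleGraph.four_mul_isolationNumber_le hG h5 h6 hex
    have h' : (4 : ℝ) * (G.isolationNumber 1 : ℝ) ≤ (Fintype.card V : ℝ) := by exact_mod_cast h
    linarith
  · rw [SimpleGraph.blockGraph_isolationNumber ht, Fintype.card_fin]
    push_cast
    ring
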